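/- For $\beta\in\mathbb R^d$ and $\sigma>0$ let $D_\beta$ be the law of $(X,y)\in\mathbb R^d\times\mathbb R$ with $X\sim\mathcal N(0,I_d)$ and $y=\beta^{T}X+\eta$, where $\eta\sim\mathcal N(0,\sigma^2)$ is independent of $X$. A $(1-\alpha)$-corrupted version of $D_\beta$ is any distribution $E=\alpha D_\beta+(1-\alpha)N$ with $N$ an arbitrary probability distribution on $\mathbb R^d\times\mathbb R$. A list-decoding algorithm with $n$ samples and list size $m$ is a (possibly randomized, computationally unrestricted) measurable procedure that receives $n$ i.i.d. samples from $E$ and outputs a list of $m$ vectors of $\mathbb R^d$, repetitions allowed; it may depend on all parameters other than $\beta$ and $N$. (Upper bound.) There is an absolute constant $C>0$ such that for all $d\ge 1$, $\alpha\in(0,1/2)$, $\sigma>0$ and $\tau\in(0,1)$ there is a list-decoding algorithm with $n\le C\,(d+\log(1/\tau))/\alpha^3$ samples (so $O(d/\alpha^3)$ for any fixed failure probability $\tau$) and list size $m\le C/\alpha$ such that, for every $\beta\in\mathbb R^d$ and every $N$, with probability at least $1-\tau$ some vector $\widehat\beta$ of the output list satisfies $\|\widehat\beta-\beta\|_2\le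 C\,\frac{\sigma}{\alpha}\sqrt{\log(1/\alpha)}$. (Lower bound.) There is an absolute constant $C>0$ such that for all $K>0$ and $\tau\in(0,1)$ there is $c>0$, depending only on $K$ and $\tau$, with the following property. Let $\alpha\in(0,1/2)$, $\sigma>0$, let $k\ge 1$ be real, and let $d$ be an integer with $d>(k\log(1/\alpha))^{C}$. Then for every list-decoding algorithm, with any number of samples and list size $m\le K(1/\alpha)^k$, there are $\beta\in\mathbb R^d$ and $N$ such that, with probability at least $1-\tau$, every vector $\widehat\beta$ of the output list satisfies $\|\widehat\beta-\beta\|_2\ge c\,\frac{\sigma}{\alpha\sqrt{k\log(1/\alpha)}}$. -/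

import Mathlib

open MeasureTheory ProbabilityTheory

/-- A labelled example `(X, y)` with `X ∈ ℝᵈ` (Euclidean norm) and `y ∈ ℝ`. -/
abbrev LabeledExample (d : ℕ) : Type := EuclideanSpace ℝ (Fin d) × ℝ

/-- The Gaussian linear regression model `D_β`: the law of `(X, βᵀX + η)`, where `X ∼ N(0, I_d)`
and `η ∼ N(0, σ²)` are independent. -/
noncomputable def gaussianLinearRegression {d : ℕ} (σ : ℝ) (β : EuclideanSpace ℝ (Fin d)) :
    Measure (LabeledExample d) :=
  ((stdGaussian (EuclideanSpace ℝ (Fin d))).prod (gaussianReal 0 (σ ^ 2).toNNReal)).map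
    (fun p => (p.1, inner ℝ β p.1 + p.2))

/-- The mixture `α D + (1 - α) N`, i.e. the `(1 - α)`-corrupted version of `D` with outlier
distribution `N`. -/
noncomputable def corrupted {d : ℕ} (α : ℝ) (D N : Measure (LabeledExample d)) :
    Measure (LabeledExample d) :=
  ENNReal.ofReal α • D + ENNReal.ofReal (1 - α) • N

/-- A (possibly randomized) list-decoding algorithm which reads `n` labelled examples and outputs
`m` hypothesis vectors in `ℝᵈ`. The entries may repeat, so that lists of size at most `m` are
included. No bound is put on its computational resources: it is a Markov kernel from samples to
lists. -/
structure ListDecoder (d n m : ℕ) where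
  /-- The conditional law of the output list given the sample. -/
  output : Kernel (Fin n → LabeledExample d) (Fin m → EuclideanSpace ℝ (Fin d))
  /-- The output is always a probability distribution. -/
  isMarkov : IsMarkovKernel output

/-- The probability, over `n` i.i.d. samples from `E` and the internal randomness of `A`, that the
output list lies in `S`. -/
noncomputable def ListDecoder.prob {d n m : ℕ} (A : ListDecoder d n m)
    (E : Measure (LabeledExample d)) (S : Set (Fin m → EuclideanSpace ℝ (Fin d))) : ℝ :=
  ((Measure.pi fun _ : Fin n => E).bind A.output).real S

/-! Lower bound. Many well-separated regressors share one corrupted law, so samples from it say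
nothing about which regressor is the true one. Take `M` points separated at scale `r * ε` in a ball
of radius `r`. Conditionally on `X` with `|⟨β, X⟩| ≤ b`, every model is dominated by one measure of
mass at most `1 + b / σ` (`exists_gaussianReal_envelope`). Adding the Gaussian tails separately for
each `β` gives a measure above every `α • D_β`; its mass stays below 1 when `b` is of order `σ / α`
and the tails are as small as `1 / M` (`exists_common_corruption`). Each list entry is close to at
most one packing point, so with `m ≤ τ * M` some point is missed with probability at least `1 - τ`.
Dimension `d > k log(1/α)` already leaves room for the packing.

Upper bound. The error reached is `O(σ/α)`, without the logarithmic factor. Greedily choose about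
`16 / α` candidates whose residual slabs leave no candidate explaining `α n / 16` new examples. To
analyse this, weight examples by the density `w` of `α • D_β` with respect to the sampling law. The
weight explained by `β` is at least `α n / 8`. An example explained by both `β` and a far candidate
lies in a slab of width `O(α)` about a hyperplane, and by Gaussian anti-concentration every such
slab has weight at most `α² n / 512`. If the whole list were far from `β`, these slabs and the few
unexplained examples could not carry the weight (`exists_norm_sub_le_of_cover`). Uniformity over
directions comes from a weighted Chernoff bound on a net of the sphere
(`measure_pi_regular_sample_compl_le`). -/

/-! ### Volume packing and nets -/

section Packing

variable {E : Type*} [NormedAddCommGroup E] [NormedSpace ℝ E] [FiniteDimensional ℝ E]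

/-- Volume bound on the cardinality of a separated subset of the unit ball. -/
lemma card_le_of_separated_of_subset_closedBall {s : Finset E} {ε : ℝ} (hε : 0 < ε) (hε1 : ε ≤ 1)
    (hs : (s : Set E) ⊆ Metric.closedBall 0 1)
    (hsep : (s : Set E).Pairwise fun x y => ε ≤ dist x y) :
    (s.card : ℝ) ≤ (3 / ε) ^ Module.finrank ℝ E := by
  borelize E
  let μ : Measure E := Measure.addHaar
  have hV : 0 < μ.real (Metric.ball 0 1) := 
    ENNReal.toReal_pos (Metric.measure_ball_pos _ _ one_pos).ne' measure_ball_lt_top.ne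
  have hdisj : (s : Set E).PairwiseDisjoint fun p => Metric.ball p (ε / 2) := fun x hx y hy hxy =>
    Metric.ball_disjoint_ball (by linarith [hsep hx hy hxy])
  have hsub : (⋃ p ∈ s, Metric.ball p (ε / 2)) ⊆ Metric.ball (0 : E) (3 / 2) := by
    refine Set.iUnion₂_subset fun p hp => Metric.ball_subset_ball' ?_
    have := Metric.mem_closedBall.1 (hs hp)
    have h1 : ε / 2 + dist p 0 ≤ 3 / 2 := by linarith
    exact h1
  have key := measureReal_mono (μ := μ) hsub Metric.isBounded_ball.measure_lt_top.ne
  rw [measureReal_biUnion_finset hdisj fun _ _ => measurableSet_ball] at key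
  have hb : ∀ (x : E) {r : ℝ}, 0 < r →
      μ.real (Metric.ball x r) = r ^ Module.finrank ℝ E * μ.real (Metric.ball 0 1) := by
    intro x r hr
    rw [measureReal_def, Measure.addHaar_ball_of_pos μ x hr, ENNReal.toReal_mul,
      ENNReal.toReal_ofReal (by positivity), measureReal_def]
  simp only [hb _ (half_pos hε), hb _ (show (0 : ℝ) < 3 / 2 by norm_num), Finset.sum_const,
    nsmul_eq_mul, ← mul_assoc] at key
  have key' := le_of_mul_le_mul_right key hV
  rw [← le_div_iff₀ (by positivity), ← div_pow] at key'
  rwa [show (3 : ℝ) / 2 / (ε / 2) = 3 / ε by field_simp] at key'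

/-- A maximal separated subset of a subset of the unit ball is a net. -/
lemma exists_separated_net {A : Set E} (hA : A ⊆ Metric.closedBall 0 1) {ε : ℝ} (hε : 0 < ε)
    (hε1 : ε ≤ 1) :
    ∃ s : Finset E, (s : Set E) ⊆ A ∧ ((s : Set E).Pairwise fun x y => ε ≤ dist x y) ∧
      (∀ x ∈ A, ∃ p ∈ s, dist x p < ε) ∧ (s.card : ℝ) ≤ (3 / ε) ^ Module.finrank ℝ E := by
  classical
  -- If no separated set were a net of the allowed size, every separated set could be enlarged,
  -- contradicting the volume bound.
  by_contra! hcon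
  have hgrow : ∀ k : ℕ, ∃ s : Finset E, (s : Set E) ⊆ A ∧
      ((s : Set E).Pairwise fun x y => ε ≤ dist x y) ∧ s.card = k := by
    intro k
    induction k with
    | zero => exact ⟨∅, by simp⟩
    | succ k ih =>
      obtain ⟨s, hsA, hsep, hcard⟩ := ih
      have hle := card_le_of_separated_of_subset_closedBall hε hε1 (hsA.trans hA) hsep
      have : ∃ x ∈ A, ∀ p ∈ s, ε ≤ dist x p := by
        by_contra! h
        exact absurd hle (not_le.2 (hcon s hsA hsep h))
      obtain ⟨x, hxA, hx⟩ := this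
      have hxs : x ∉ s := fun h => by simpa [hε.not_ge] using hx x h
      refine ⟨insert x s, ?_, ?_, by rw [Finset.card_insert_of_notMem hxs, hcard]⟩
      · rw [Finset.coe_insert]
        exact Set.insert_subset hxA hsA
      · rw [Finset.coe_insert]
        refine hsep.insert fun y hy _ => ⟨hx y hy, ?_⟩
        rw [dist_comm]
        exact hx y hy
  obtain ⟨k, hk⟩ := exists_nat_gt ((3 / ε) ^ Module.finrank ℝ E)
  obtain ⟨s, hsA, hsep, hcard⟩ := hgrow k
  have := card_le_of_separated_of_subset_closedBall hε hε1 (hsA.trans hA) hsep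
  rw [hcard] at this
  linarith

/-- The unit ball contains large separated subsets. -/
lemma exists_separated_card_eq {ε : ℝ} (hε : 0 < ε) (hε1 : ε ≤ 1) {M : ℕ}
    (hM : (M : ℝ) ≤ (1 / ε) ^ Module.finrank ℝ E) :
    ∃ s : Finset E, (s : Set E) ⊆ Metric.closedBall 0 1 ∧
      ((s : Set E).Pairwise fun x y => ε ≤ dist x y) ∧ s.card = M := by
  borelize E
  let μ : Measure E := Measure.addHaar
  obtain ⟨s, hsA, hsep, hnet, -⟩ :=
    exists_separated_net (A := Metric.closedBall (0 : E) 1) subset_rfl hε hε1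
  have hV : 0 < μ.real (Metric.closedBall 0 1) := 
    ENNReal.toReal_pos (Metric.measure_closedBall_pos _ _ one_pos).ne' measure_closedBall_lt_top.ne
  have hcov : Metric.closedBall (0 : E) 1 ⊆ ⋃ p ∈ s, Metric.closedBall p ε := fun x hx => by
    obtain ⟨p, hp, hxp⟩ := hnet x hx
    exact Set.mem_iUnion₂.2 ⟨p, hp, hxp.le⟩
  have h1 : μ.real (Metric.closedBall (0 : E) 1) ≤ ∑ p ∈ s, μ.real (Metric.closedBall p ε) := by
    refine (measureReal_mono hcov ?_).trans (measureReal_biUnion_finset_le _ _)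
    exact ((Bornology.isBounded_biUnion_finset s).2
      fun p _ => Metric.isBounded_closedBall).measure_lt_top.ne
  simp only [Measure.addHaar_real_closedBall' μ _ hε.le, Finset.sum_const, nsmul_eq_mul,
    ← mul_assoc] at h1
  have h2 : 1 ≤ (s.card : ℝ) * ε ^ Module.finrank ℝ E :=
    le_of_mul_le_mul_right (by simpa using h1) hV
  have h3 : M ≤ s.card := by
    have : (M : ℝ) ≤ s.card := by
      refine hM.trans ?_
      rw [one_div, inv_pow, inv_le_iff_one_le_mul₀ (by positivity)]
      exact h2
    exact_mod_cast this
  obtain ⟨t, hts, ht⟩ := Finset.exists_subset_card_eq h3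
  exact ⟨t, fun x hx => hsA (hts hx), hsep.mono (by exact_mod_cast hts), ht⟩

end Packing

/-! ### Tails and anti-concentration of Gaussian marginals -/

section StdGaussian

variable {E : Type*} [NormedAddCommGroup E] [InnerProductSpace ℝ E] [FiniteDimensional ℝ E]
  [MeasurableSpace E] [BorelSpace E]

lemma stdGaussian_map_inner (u : E) :
    (stdGaussian E).map (fun x => inner ℝ u x) = gaussianReal 0 (‖u‖ ^ 2).toNNReal := by
  have h := IsGaussian.map_eq_gaussianReal (μ := stdGaussian E) (innerSL ℝ u)
  rw [integral_strongDual_stdGaussian, variance_dual_stdGaussian, innerSL_apply_norm] at h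
  exact h

/-- The exact value is `√2`. This one moment gives both the Gaussian tails and the concentration of
second moments. -/
lemma lintegral_exp_sq_gaussianReal :
    ∫⁻ t, ENNReal.ofReal (Real.exp (t ^ 2 / 4)) ∂(gaussianReal 0 1) ≤ 2 := by
  rw [gaussianReal_of_var_ne_zero _ one_ne_zero,
    lintegral_withDensity_eq_lintegral_mul _ (measurable_gaussianPDF _ _) (by fun_prop)]
  have h1 : ∀ t : ℝ, (gaussianPDF 0 1 * fun t => ENNReal.ofReal (Real.exp (t ^ 2 / 4))) t
      = ENNReal.ofReal ((√(2 * Real.pi))⁻¹ * Real.exp (-(1 / 4) * t ^ 2)) := by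
    intro t
    simp only [Pi.mul_apply, gaussianPDF, gaussianPDFReal]
    rw [← ENNReal.ofReal_mul (by positivity), mul_assoc, ← Real.exp_add]
    norm_num
    ring_nf
  simp_rw [h1]
  rw [← ofReal_integral_eq_lintegral_ofReal
    ((integrable_exp_neg_mul_sq (by norm_num)).const_mul _)
    (Filter.Eventually.of_forall fun t => by positivity), integral_const_mul, integral_gaussian]
  rw [← Real.sqrt_inv, ← Real.sqrt_mul (by positivity)]
  refine ENNReal.ofReal_le_of_le_toReal ?_
  rw [ENNReal.toReal_ofNat]
  refine Real.sqrt_le_iff.2 ⟨by norm_num, ?_⟩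
  have := Real.pi_pos
  field_simp
  norm_num

lemma lintegral_exp_inner_sq_stdGaussian {u : E} (hu : ‖u‖ ≤ 1) :
    ∫⁻ x, ENNReal.ofReal (Real.exp (inner ℝ u x ^ 2 / 4)) ∂(stdGaussian E) ≤ 2 := by
  have h1 : ∫⁻ x, ENNReal.ofReal (Real.exp (inner ℝ u x ^ 2 / 4)) ∂(stdGaussian E)
      = ∫⁻ t, ENNReal.ofReal (Real.exp (t ^ 2 / 4)) ∂(gaussianReal 0 (‖u‖ ^ 2).toNNReal) := by
    rw [← stdGaussian_map_inner, lintegral_map (by fun_prop) (by fun_prop)]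
  have h2 := gaussianReal_map_const_mul (μ := 0) (v := 1) ‖u‖
  rw [mul_zero, mul_one] at h2
  have h3 : (‖u‖ ^ 2).toNNReal = NNReal.mk (‖u‖ ^ 2) (sq_nonneg _) :=
    Real.toNNReal_of_nonneg (sq_nonneg _)
  rw [h1, h3, ← h2, lintegral_map (by fun_prop) (by fun_prop)]
  refine le_trans (lintegral_mono fun t => ?_) lintegral_exp_sq_gaussianReal
  refine ENNReal.ofReal_le_ofReal (Real.exp_le_exp.2 ?_)
  rw [mul_pow]
  have : ‖u‖ ^ 2 ≤ 1 := pow_le_one₀ (norm_nonneg _) hu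
  nlinarith [sq_nonneg t]

lemma stdGaussian_abs_inner_gt_le {u : E} (hu : ‖u‖ ≤ 1) {w : ℝ} (hw : 0 ≤ w) :
    stdGaussian E {x | w < |inner ℝ u x|} ≤ ENNReal.ofReal (2 * Real.exp (-(w ^ 2 / 4))) := by
  have hsub : {x : E | w < |inner ℝ u x|} ⊆ {x | ENNReal.ofReal (Real.exp (w ^ 2 / 4)) ≤
      ENNReal.ofReal (Real.exp (inner ℝ u x ^ 2 / 4))} := by
    intro x hx
    refine ENNReal.ofReal_le_ofReal (Real.exp_le_exp.2 ?_)
    have : w ^ 2 ≤ inner ℝ u x ^ 2 := sq_le_sq.2 (by rw [abs_of_nonneg hw]; exact le_of_lt hx)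
    linarith
  refine (measure_mono hsub).trans ?_
  refine (meas_ge_le_lintegral_div (by fun_prop) (by simp [Real.exp_pos])
    ENNReal.ofReal_ne_top).trans ?_
  refine (ENNReal.div_le_div_right (lintegral_exp_inner_sq_stdGaussian hu) _).trans ?_
  rw [Real.exp_neg, ← div_eq_mul_inv, ENNReal.ofReal_div_of_pos (Real.exp_pos _),
    ENNReal.ofReal_ofNat]

/-- The density is at most `1 / √(2π) ≤ 1 / 2`, and the interval has length `2a`. -/
lemma gaussianReal_Icc_le (a : ℝ) :
    gaussianReal 0 1 (Set.Icc (-a) a) ≤ ENNReal.ofReal a := by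
  rw [gaussianReal_apply _ one_ne_zero]
  calc ∫⁻ x in Set.Icc (-a) a, gaussianPDF 0 1 x
      ≤ ∫⁻ _ in Set.Icc (-a) a, ENNReal.ofReal (1 / 2) := by
        refine lintegral_mono fun x => ENNReal.ofReal_le_ofReal ?_
        simp only [gaussianPDFReal]
        have h1 : Real.exp (-(x - 0) ^ 2 / (2 * ((1 : NNReal) : ℝ))) ≤ 1 :=
          Real.exp_le_one_iff.2 (by
            rw [NNReal.coe_one, mul_one]
            nlinarith [sq_nonneg (x - 0)])
        have h2 : (√(2 * Real.pi * ((1 : NNReal) : ℝ)))⁻¹ ≤ 1 / 2 := by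
          rw [one_div]
          refine inv_anti₀ (by norm_num) (Real.le_sqrt_of_sq_le ?_)
          rw [NNReal.coe_one]
          nlinarith [Real.pi_gt_three]
        calc _ ≤ (1 / 2 : ℝ) * 1 := mul_le_mul h2 h1 (Real.exp_pos _).le (by norm_num)
          _ = 1 / 2 := mul_one _
    _ = ENNReal.ofReal a := by
        rw [setLIntegral_const, Real.volume_Icc, ← ENNReal.ofReal_mul (by norm_num)]
        ring_nf

lemma stdGaussian_abs_inner_le_le {u : E} (hu : ‖u‖ = 1) (a : ℝ) :
    stdGaussian E {x | |inner ℝ u x| ≤ a} ≤ ENNReal.ofReal a := by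
  have h1 : {x : E | |inner ℝ u x| ≤ a} = (fun x => inner ℝ u x) ⁻¹' Set.Icc (-a) a := by
    ext x
    simp [abs_le]
  rw [h1, ← Measure.map_apply (by fun_prop) measurableSet_Icc, stdGaussian_map_inner, hu]
  simpa using gaussianReal_Icc_le a

end StdGaussian

/-! ### A common majorant for shifted Gaussians -/

section Envelope

lemma gaussianPDFReal_le_of_abs_sub_le {v : NNReal} {c b y : ℝ} (h : |y - b| ≤ |y - c|) :
    gaussianPDFReal c v y ≤ gaussianPDFReal b v y := by
  simp only [gaussianPDFReal]
  have := sq_le_sq.2 h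
  gcongr

lemma gaussianPDFReal_le_inv {σ : ℝ} (hσ : 0 < σ) (c y : ℝ) :
    gaussianPDFReal c (σ ^ 2).toNNReal y ≤ 1 / (2 * σ) := by
  simp only [gaussianPDFReal]
  have h1 : Real.exp (-(y - c) ^ 2 / (2 * ((σ ^ 2).toNNReal : ℝ))) ≤ 1 := by
    refine Real.exp_le_one_iff.2 ?_
    rw [neg_div]
    exact neg_nonpos.2 (by positivity)
  have h2 : (√(2 * Real.pi * ((σ ^ 2).toNNReal : ℝ)))⁻¹ ≤ 1 / (2 * σ) := by
    rw [one_div, Real.coe_toNNReal _ (sq_nonneg _)]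
    refine inv_anti₀ (by positivity) (Real.le_sqrt_of_sq_le ?_)
    nlinarith [Real.pi_gt_three, sq_pos_of_pos hσ]
  calc _ ≤ (1 / (2 * σ) : ℝ) * 1 := mul_le_mul h2 h1 (Real.exp_pos _).le (by positivity)
    _ = 1 / (2 * σ) := mul_one _

/-- A measure of mass at most `1 + b / σ` dominates every Gaussian with variance `σ ^ 2` and mean in
`[-b, b]`. -/
lemma exists_gaussianReal_envelope {σ b : ℝ} (hσ : 0 < σ) (hb : 0 ≤ b) :
    ∃ ρ : Measure ℝ, ρ Set.univ ≤ ENNReal.ofReal (1 + b / σ) ∧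
      ∀ c, |c| ≤ b → gaussianReal c (σ ^ 2).toNNReal ≤ ρ := by
  set v := (σ ^ 2).toNNReal with hv_def
  have hv : v ≠ 0 := by
    rw [hv_def, Ne, Real.toNNReal_eq_zero, not_le]
    positivity
  -- Inside `[-b, b]` the density is at most `1 / (2σ)`, at a cost of `b / σ`. Outside, the Gaussian
  -- centred at the nearer endpoint dominates, and the two half-Gaussians have total mass at most 1.
  refine ⟨ENNReal.ofReal (1 / (2 * σ)) • volume.restrict (Set.Icc (-b) b) +
    ((gaussianReal b v).restrict (Set.Ioi b) + (gaussianReal (-b) v).restrict (Set.Iio (-b))),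
    ?_, ?_⟩
  · have h1 : gaussianReal b v (Set.Ioi b) = gaussianReal 0 v (Set.Ioi 0) := by
      have := gaussianReal_map_add_const (μ := 0) (v := v) b
      rw [zero_add] at this
      rw [← this, Measure.map_apply (by fun_prop) measurableSet_Ioi]
      congr 1
      ext x
      simp
    have h2 : gaussianReal (-b) v (Set.Iio (-b)) = gaussianReal 0 v (Set.Iio 0) := by
      have := gaussianReal_map_add_const (μ := 0) (v := v) (-b)
      rw [zero_add] at this
      rw [← this, Measure.map_apply (by fun_prop) measurableSet_Iio]
      congr 1
      ext x
      simp
    have h3 : gaussianReal 0 v (Set.Ioi 0) + gaussianReal 0 v (Set.Iio 0) ≤ 1 := by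
      have hd : Disjoint (Set.Ioi (0 : ℝ)) (Set.Iio 0) :=
        Set.disjoint_left.2 fun x (hx : 0 < x) (hx' : x < 0) => lt_asymm hx hx'
      rw [← measure_union hd measurableSet_Iio]
      exact prob_le_one
    simp only [Measure.add_apply, Measure.smul_apply, Measure.restrict_apply_univ, smul_eq_mul,
      Real.volume_Icc, h1, h2]
    rw [← ENNReal.ofReal_mul (by positivity), add_comm 1 (b / σ),
      ENNReal.ofReal_add (by positivity) zero_le_one, ENNReal.ofReal_one]
    refine add_le_add (le_of_eq ?_) h3
    congr 1
    field_simp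
    ring
  · intro c hc
    obtain ⟨hc1, hc2⟩ := abs_le.1 hc
    have hcover : gaussianReal c v ≤ (gaussianReal c v).restrict (Set.Icc (-b) b) +
        ((gaussianReal c v).restrict (Set.Ioi b) + (gaussianReal c v).restrict (Set.Iio (-b))) := by
      have hu : (Set.univ : Set ℝ) = Set.Icc (-b) b ∪ (Set.Ioi b ∪ Set.Iio (-b)) := by
        ext x
        simp only [Set.mem_univ, Set.mem_union, Set.mem_Icc, Set.mem_Ioi, Set.mem_Iio, true_iff]
        grind
      calc gaussianReal c v = (gaussianReal c v).restrict Set.univ := Measure.restrict_univ.symm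
        _ ≤ _ := by
          rw [hu]
          refine (Measure.restrict_union_le _ _).trans ?_
          gcongr
          exact Measure.restrict_union_le _ _
    refine hcover.trans (add_le_add ?_ (add_le_add ?_ ?_))
    · rw [gaussianReal_of_var_ne_zero _ hv, restrict_withDensity measurableSet_Icc,
        ← withDensity_const]
      exact withDensity_mono (Filter.Eventually.of_forall fun y =>
        ENNReal.ofReal_le_ofReal (gaussianPDFReal_le_inv hσ c y))
    · rw [gaussianReal_of_var_ne_zero _ hv, gaussianReal_of_var_ne_zero _ hv,
        restrict_withDensity measurableSet_Ioi, restrict_withDensity measurableSet_Ioi]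
      refine withDensity_mono (ae_restrict_of_forall_mem measurableSet_Ioi fun y hy =>
        ENNReal.ofReal_le_ofReal (gaussianPDFReal_le_of_abs_sub_le ?_))
      have hy' : b < y := hy
      rw [abs_of_nonneg (by linarith), abs_of_nonneg (by linarith)]
      linarith
    · rw [gaussianReal_of_var_ne_zero _ hv, gaussianReal_of_var_ne_zero _ hv,
        restrict_withDensity measurableSet_Iio, restrict_withDensity measurableSet_Iio]
      refine withDensity_mono (ae_restrict_of_forall_mem measurableSet_Iio fun y hy =>
        ENNReal.ofReal_le_ofReal (gaussianPDFReal_le_of_abs_sub_le ?_))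
      have hy' : y < -b := hy
      rw [abs_of_nonpos (by linarith), abs_of_nonpos (by linarith)]
      linarith

end Envelope

/-! ### The regression model and a shared corruption -/

section Model

variable {d : ℕ}

instance isProbabilityMeasure_gaussianLinearRegression (σ : ℝ) (β : EuclideanSpace ℝ (Fin d)) :
    IsProbabilityMeasure (gaussianLinearRegression σ β) :=
  Measure.isProbabilityMeasure_map (Measurable.aemeasurable (by fun_prop))

lemma lintegral_gaussianLinearRegression (σ : ℝ) (β : EuclideanSpace ℝ (Fin d))
    {f : LabeledExample d → ENNReal} (hf : Measurable f) :
    ∫⁻ z, f z ∂(gaussianLinearRegression σ β) =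
      ∫⁻ x, ∫⁻ e, f (x, inner ℝ β x + e) ∂(gaussianReal 0 (σ ^ 2).toNNReal)
        ∂(stdGaussian (EuclideanSpace ℝ (Fin d))) := by
  rw [gaussianLinearRegression, lintegral_map hf (by fun_prop), lintegral_prod]
  exact (hf.comp (by fun_prop)).aemeasurable

lemma gaussianLinearRegression_apply (σ : ℝ) (β : EuclideanSpace ℝ (Fin d))
    {S : Set (LabeledExample d)} (hS : MeasurableSet S) :
    gaussianLinearRegression σ β S =
      ∫⁻ x, gaussianReal (inner ℝ β x) (σ ^ 2).toNNReal (Prod.mk x ⁻¹' S)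
        ∂(stdGaussian (EuclideanSpace ℝ (Fin d))) := by
  rw [gaussianLinearRegression, Measure.map_apply (by fun_prop) hS,
    Measure.prod_apply (hS.preimage (by fun_prop))]
  refine lintegral_congr fun x => ?_
  have := gaussianReal_map_const_add (μ := 0) (v := (σ ^ 2).toNNReal) (inner ℝ β x)
  rw [zero_add] at this
  rw [← this, Measure.map_apply (by fun_prop) (hS.preimage (by fun_prop))]
  rfl

lemma gaussianLinearRegression_fst_preimage (σ : ℝ) (β : EuclideanSpace ℝ (Fin d))
    {S : Set (EuclideanSpace ℝ (Fin d))} (hS : MeasurableSet S) :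
    gaussianLinearRegression σ β (Prod.fst ⁻¹' S) = stdGaussian _ S := by
  rw [gaussianLinearRegression, Measure.map_apply (by fun_prop) (hS.preimage measurable_fst)]
  change ((stdGaussian _).prod _) (Prod.fst ⁻¹' S) = _
  rw [← Measure.map_apply measurable_fst hS, Measure.map_fst_prod]
  simp

/-- Away from large values of the regression function, the model is dominated by a product. -/
lemma gaussianLinearRegression_le_prod_add (σ : ℝ) (β : EuclideanSpace ℝ (Fin d)) {b : ℝ}
    {ρ : Measure ℝ} [SFinite ρ]
    (hρ : ∀ c, |c| ≤ b → gaussianReal c (σ ^ 2).toNNReal ≤ ρ) :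
    gaussianLinearRegression σ β ≤ (stdGaussian (EuclideanSpace ℝ (Fin d))).prod ρ +
      (gaussianLinearRegression σ β).restrict {z | b < |inner ℝ β z.1|} := by
  have hG : MeasurableSet {z : LabeledExample d | b < |inner ℝ β z.1|} :=
    measurableSet_lt (by fun_prop) (by fun_prop)
  rw [← Measure.restrict_compl_add_restrict hG (μ := gaussianLinearRegression σ β)]
  simp only [Measure.restrict_add, Measure.restrict_restrict hG]
  simp only [Set.inter_compl_self, Set.inter_self, Measure.restrict_empty, zero_add]
  gcongr
  refine Measure.le_iff.2 fun S hS => ?_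
  rw [Measure.restrict_apply hS, gaussianLinearRegression_apply σ β (hS.inter hG.compl),
    Measure.prod_apply hS]
  refine lintegral_mono fun x => ?_
  by_cases hx : |inner ℝ β x| ≤ b
  · exact (hρ _ hx _).trans (measure_mono fun y hy => hy.1)
  · have : Prod.mk x ⁻¹' (S ∩ {z : LabeledExample d | b < |inner ℝ β z.1|}ᶜ) = ∅ := by
      ext y
      simp only [Set.mem_preimage, Set.mem_inter_iff, Set.mem_compl_iff, Set.mem_ofPred_eq,
        Set.mem_empty_iff_false, iff_false, not_and, not_not]
      exact fun _ => not_le.1 hx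
    simp [this]

/-- Domination makes `E - α • D` a positive measure of mass `1 - α`; normalised, it is the outlier
law. -/
lemma exists_corrupted_eq {α : ℝ} (hα : 0 ≤ α) (hα1 : α < 1) {D E : Measure (LabeledExample d)}
    [IsProbabilityMeasure D] [IsProbabilityMeasure E] (h : ENNReal.ofReal α • D ≤ E) :
    ∃ N : Measure (LabeledExample d), IsProbabilityMeasure N ∧ corrupted α D N = E := by
  have h1 : ENNReal.ofReal (1 - α) ≠ 0 := by simpa using hα1
  have hfin : IsFiniteMeasure (ENNReal.ofReal α • D) := Measure.smul_finite D ENNReal.ofReal_ne_top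
  refine ⟨(ENNReal.ofReal (1 - α))⁻¹ • (E - ENNReal.ofReal α • D), ⟨?_⟩, ?_⟩
  · rw [Measure.smul_apply, Measure.sub_apply MeasurableSet.univ h, Measure.smul_apply]
    simp only [measure_univ, smul_eq_mul, mul_one]
    rw [show (1 : ENNReal) - ENNReal.ofReal α = ENNReal.ofReal (1 - α) by
      rw [ENNReal.ofReal_sub _ hα, ENNReal.ofReal_one]]
    exact ENNReal.inv_mul_cancel h1 ENNReal.ofReal_ne_top
  · rw [corrupted, smul_smul, ENNReal.mul_inv_cancel h1 ENNReal.ofReal_ne_top, one_smul, add_comm]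
    exact Measure.sub_add_cancel_of_le h

/-- One distribution is a corrupted version of many regression models at once. -/
lemma exists_common_corruption {α σ b δ : ℝ} (hα : 0 < α) (hα1 : α < 1) (hσ : 0 < σ) (hb : 0 ≤ b)
    (hδ : 0 ≤ δ) (s : Finset (EuclideanSpace ℝ (Fin d)))
    (htail : ∀ β ∈ s, stdGaussian _ {x | b < |inner ℝ β x|} ≤ ENNReal.ofReal δ)
    (hmass : α * (1 + b / σ) + s.card * (α * δ) ≤ 1) :
    ∃ E : Measure (LabeledExample d), IsProbabilityMeasure E ∧ ∀ β ∈ s, ∃ N,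
      IsProbabilityMeasure N ∧ corrupted α (gaussianLinearRegression σ β) N = E := by
  obtain ⟨ρ, hρ1, hρ⟩ := exists_gaussianReal_envelope hσ hb
  have hρfin : IsFiniteMeasure ρ := ⟨hρ1.trans_lt ENNReal.ofReal_lt_top⟩
  let bad := fun β : EuclideanSpace ℝ (Fin d) => {z : LabeledExample d | b < |inner ℝ β z.1|}
  -- The product part is paid for once, whatever the number of regressors; only the tails are summed
  -- over `s`.
  let F : Measure (LabeledExample d) := ENNReal.ofReal α • (stdGaussian _).prod ρ +
    ∑ β ∈ s, ENNReal.ofReal α • (gaussianLinearRegression σ β).restrict (bad β)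
  have hF : F Set.univ ≤ 1 := by
    simp only [F, Measure.add_apply, Measure.smul_apply, Measure.finsetSum_apply, smul_eq_mul,
      Measure.restrict_apply_univ]
    have h1 : ((stdGaussian (EuclideanSpace ℝ (Fin d))).prod ρ) Set.univ
        ≤ ENNReal.ofReal (1 + b / σ) := by
      rw [← Set.univ_prod_univ, Measure.prod_prod, measure_univ, one_mul]
      exact hρ1
    have h2 : ∀ β ∈ s, ENNReal.ofReal α * gaussianLinearRegression σ β (bad β)
        ≤ ENNReal.ofReal (α * δ) := by
      intro β hβ
      rw [ENNReal.ofReal_mul hα.le]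
      gcongr
      refine le_trans (le_of_eq ?_) (htail β hβ)
      exact gaussianLinearRegression_fst_preimage σ β (S := {x | b < |inner ℝ β x|})
        (measurableSet_lt (by fun_prop) (by fun_prop))
    calc _ ≤ ENNReal.ofReal α * ENNReal.ofReal (1 + b / σ) +
        ∑ β ∈ s, ENNReal.ofReal (α * δ) := by
          gcongr with β hβ
          exact h2 β hβ
      _ = ENNReal.ofReal (α * (1 + b / σ) + s.card * (α * δ)) := by
          rw [Finset.sum_const, nsmul_eq_mul, ← ENNReal.ofReal_mul hα.le,
            ENNReal.ofReal_add (by positivity) (by positivity),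
            ENNReal.ofReal_mul (Nat.cast_nonneg _), ENNReal.ofReal_natCast]
      _ ≤ 1 := ENNReal.ofReal_le_one.2 hmass
  -- The point mass only fills the total mass up to 1.
  let E := F + (1 - F Set.univ) • Measure.dirac (0 : LabeledExample d)
  have hE : IsProbabilityMeasure E := ⟨by
    simp only [E, Measure.add_apply, Measure.smul_apply, measure_univ, smul_eq_mul, mul_one]
    exact add_tsub_cancel_of_le hF⟩
  refine ⟨E, hE, fun β hβ => exists_corrupted_eq hα.le hα1 ?_⟩
  refine le_trans ?_ (Measure.le_add_right le_rfl : F ≤ E)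
  calc ENNReal.ofReal α • gaussianLinearRegression σ β
      ≤ ENNReal.ofReal α • ((stdGaussian _).prod ρ +
        (gaussianLinearRegression σ β).restrict (bad β)) := by
        refine Measure.le_iff.2 fun S _ => ?_
        rw [Measure.smul_apply, Measure.smul_apply]
        exact mul_le_mul_right (gaussianLinearRegression_le_prod_add σ β hρ S) _
    _ ≤ F := by
        rw [smul_add]
        refine add_le_add le_rfl ?_
        exact Finset.single_le_sum
          (f := fun β => ENNReal.ofReal α • (gaussianLinearRegression σ β).restrict (bad β))
          (fun _ _ => Measure.zero_le _) hβ

end Model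

/-! ### Pigeonhole and the lower bound -/

/-- A random list of `m` points misses, with probability at least `1 - τ`, a neighbourhood of one of
sufficiently many separated points. -/
lemma exists_measureReal_forall_le_norm_sub {E : Type*} [NormedAddCommGroup E] [MeasurableSpace E]
    [BorelSpace E] [SecondCountableTopology E] {m : ℕ} (μ : Measure (Fin m → E))
    [IsProbabilityMeasure μ] {s : Finset E} (hs : s.Nonempty) {r τ : ℝ}
    (hsep : (s : Set E).Pairwise fun x y => 2 * r ≤ dist x y) (hm : (m : ℝ) ≤ τ * s.card) :
    ∃ β ∈ s, 1 - τ ≤ μ.real {l | ∀ i, r ≤ ‖l i - β‖} := by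
  by_contra! hcon
  have hmeas : ∀ (β : E) (i : Fin m), MeasurableSet {l : Fin m → E | ‖l i - β‖ < r} :=
    fun β i => measurableSet_lt (by fun_prop) measurable_const
  -- Double counting: every `β` is hit with probability above `τ`, yet each entry is within `r` of
  -- at most one point of `s`, so the hitting probabilities sum to at most `m`.
  have h1 : ∀ β ∈ s, τ < ∑ i, μ.real {l | ‖l i - β‖ < r} := by
    intro β hβ
    have hgood : MeasurableSet {l : Fin m → E | ∀ i, r ≤ ‖l i - β‖} := by
      rw [Set.ofPred_forall]
      exact MeasurableSet.iInter fun i =>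
        measurableSet_le measurable_const (by fun_prop)
    have h2 := hcon β hβ
    have h3 := probReal_compl_eq_one_sub hgood (μ := μ)
    have h4 : {l : Fin m → E | ∀ i, r ≤ ‖l i - β‖}ᶜ ⊆ ⋃ i, {l | ‖l i - β‖ < r} := by
      intro l hl
      simpa using hl
    have h5 := (measureReal_mono h4 (μ := μ)).trans (measureReal_iUnion_fintype_le _)
    linarith
  have h2 : ∀ i : Fin m, ∑ β ∈ s, μ.real {l | ‖l i - β‖ < r} ≤ 1 := by
    intro i
    rw [← measureReal_biUnion_finset _ fun β _ => hmeas β i]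
    · exact measureReal_le_one
    · intro x hx y hy hxy
      refine Set.disjoint_left.2 fun l hlx hly => ?_
      have h3 := hsep hx hy hxy
      have h4 : ‖l i - x‖ < r := hlx
      have h5 : ‖l i - y‖ < r := hly
      rw [← dist_eq_norm] at h4 h5
      have := dist_triangle_left x y (l i)
      linarith
  have h3 : τ * s.card < ∑ β ∈ s, ∑ i, μ.real {l | ‖l i - β‖ < r} := by
    calc τ * s.card = ∑ β ∈ s, τ := by rw [Finset.sum_const, nsmul_eq_mul, mul_comm]
      _ < _ := Finset.sum_lt_sum_of_nonempty hs h1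
  rw [Finset.sum_comm] at h3
  have h4 : ∑ i : Fin m, ∑ β ∈ s, μ.real {l | ‖l i - β‖ < r} ≤ ∑ _i : Fin m, (1 : ℝ) :=
    Finset.sum_le_sum fun i _ => h2 i
  simp only [Finset.sum_const, Finset.card_univ, Fintype.card_fin, nsmul_eq_mul, mul_one] at h4
  linarith

/-- Lower bound on the error of list decoding, for arbitrary sample and list sizes. -/
lemma listDecoder_lower_bound {K τ : ℝ} (hK : 0 < K) (hτ : 0 < τ) :
    ∃ c : ℝ, 0 < c ∧
      ∀ (d : ℕ) (α σ k : ℝ), 0 < α → α < 1 / 2 → 0 < σ → 1 ≤ k →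
        k * Real.log (1 / α) < (d : ℝ) →
        ∀ (n m : ℕ) (A : ListDecoder d n m), (m : ℝ) ≤ K * (1 / α) ^ k →
          ∃ (β : EuclideanSpace ℝ (Fin d)) (N : Measure (LabeledExample d)),
            IsProbabilityMeasure N ∧
            1 - τ ≤ A.prob (corrupted α (gaussianLinearRegression σ β) N)
              {l | ∀ i, c * (σ / (α * Real.sqrt (k * Real.log (1 / α)))) ≤ ‖l i - β‖} := by
  -- The summand 2 absorbs the ceiling and the extra 1 in `M`, so that `M ≤ Q * exp L`.
  set Q : ℝ := K / τ + 2 with hQ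
  have hQ2 : 2 < Q := by
    have : 0 < K / τ := by positivity
    linarith
  have hlog2 : 0 < Real.log 2 := Real.log_pos one_lt_two
  set A₁ : ℝ := Real.log (4 * Q) with hA₁
  have hA₁pos : 0 < A₁ := Real.log_pos (by linarith)
  set a : ℝ := A₁ / Real.log 2 + 1 with ha
  have hapos : 0 < a := by positivity
  -- Then `(1 / ε) ^ d = (Q * e) ^ d ≥ Q * exp L` once `d > L`: the ball holds the required packing.
  set ε : ℝ := 1 / (Q * Real.exp 1) with hε
  have hQe : 1 ≤ Q * Real.exp 1 := by nlinarith [Real.add_one_le_exp (1 : ℝ)]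
  have hεpos : 0 < ε := by positivity
  have hε1 : ε ≤ 1 := (div_le_one (by linarith)).2 hQe
  refine ⟨ε / (16 * √a), by positivity, ?_⟩
  intro d α σ k hα hα2 hσ hk hd n m A hm
  set L : ℝ := k * Real.log (1 / α) with hL
  have hL2 : Real.log 2 ≤ L := by
    have h1 : Real.log 2 ≤ Real.log (1 / α) :=
      Real.log_le_log two_pos (by rw [le_div_iff₀ hα]; linarith)
    nlinarith
  have hLpos : 0 < L := hlog2.trans_le hL2
  have hexpL : (1 / α) ^ k = Real.exp L := by
    rw [Real.rpow_def_of_pos (by positivity), hL, mul_comm]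
  have hd1 : 1 ≤ d := by
    have : (0 : ℝ) < d := hLpos.trans hd
    exact_mod_cast this
  set M : ℕ := ⌈(m : ℝ) / τ⌉₊ + 1 with hM
  have hMle : (M : ℝ) ≤ Q * Real.exp L := by
    have h1 : (⌈(m : ℝ) / τ⌉₊ : ℝ) < m / τ + 1 := Nat.ceil_lt_add_one (by positivity)
    have h2 : (m : ℝ) / τ ≤ K / τ * Real.exp L := by
      rw [hexpL] at hm
      calc (m : ℝ) / τ ≤ K * Real.exp L / τ := by gcongr
        _ = _ := by ring
    have h3 : 1 ≤ Real.exp L := Real.one_le_exp hLpos.le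
    rw [hM, hQ]
    push_cast
    nlinarith
  have hMge : (m : ℝ) ≤ τ * M := by
    have h1 : (m : ℝ) / τ ≤ M := (Nat.le_ceil _).trans (by rw [hM]; push_cast; linarith)
    rwa [div_le_iff₀' hτ] at h1
  have hMpos : 0 < M := Nat.succ_pos _
  have hMpack : (M : ℝ) ≤ (1 / ε) ^ Module.finrank ℝ (EuclideanSpace ℝ (Fin d)) := by
    rw [finrank_euclideanSpace_fin, hε, one_div_one_div, mul_pow, ← Real.exp_nat_mul, mul_one]
    refine hMle.trans ?_
    gcongr
    exact le_self_pow₀ (by linarith) (by omega)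
  obtain ⟨P, hPball, hPsep, hPcard⟩ := exists_separated_card_eq hεpos hε1 hMpack
  -- Chosen so that a single tail is at most `1 / (2 * Q * exp L)`; all `M` tails together then cost
  -- at most `α / 2`.
  set w : ℝ := 2 * √(A₁ + L) with hw
  have hwpos : 0 < w := by positivity
  have hwle : w ≤ 2 * (√a * √L) := by
    rw [hw, ← Real.sqrt_mul hapos.le]
    gcongr
    rw [ha, add_mul, one_mul, div_mul_eq_mul_div]
    gcongr
    rw [le_div_iff₀ hlog2]
    gcongr
  have hwexp : Real.exp (-(w ^ 2 / 4)) = 1 / (4 * Q * Real.exp L) := by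
    rw [hw, mul_pow, Real.sq_sqrt (by positivity), one_div,
      ← Real.exp_log (by positivity : 0 < 4 * Q), ← Real.exp_add, ← Real.exp_neg]
    congr 1
    rw [hA₁]
    ring
  -- This makes `r * w / σ = 1 / (4α)`, so the common part costs `α + 1 / 4`.
  set r : ℝ := σ / (4 * α * w) with hr
  have hrpos : 0 < r := by positivity
  let s : Finset (EuclideanSpace ℝ (Fin d)) := P.image fun p => r • p
  have hinj : Function.Injective fun p : EuclideanSpace ℝ (Fin d) => r • p :=
    smul_right_injective _ hrpos.ne'
  have hscard : s.card = M := by rw [Finset.card_image_of_injective _ hinj, hPcard]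
  have htail : ∀ β ∈ s, stdGaussian (EuclideanSpace ℝ (Fin d)) {x | r * w < |inner ℝ β x|} ≤
      ENNReal.ofReal (2 * Real.exp (-(w ^ 2 / 4))) := by
    intro β hβ
    obtain ⟨p, hp, rfl⟩ := Finset.mem_image.1 hβ
    have hp1 : ‖p‖ ≤ 1 := by simpa using hPball hp
    refine le_trans (le_of_eq ?_) (stdGaussian_abs_inner_gt_le hp1 hwpos.le)
    congr 1
    ext x
    simp only [Set.mem_ofPred_eq, real_inner_smul_left, abs_mul, abs_of_pos hrpos]
    exact mul_lt_mul_iff_right₀ hrpos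
  have hmass : α * (1 + r * w / σ) + s.card * (α * (2 * Real.exp (-(w ^ 2 / 4)))) ≤ 1 := by
    have h1 : α * (1 + r * w / σ) = α + 1 / 4 := by
      rw [hr]
      field_simp
    have h2 : (s.card : ℝ) * (α * (2 * Real.exp (-(w ^ 2 / 4)))) ≤ α / 2 := by
      rw [hscard, hwexp]
      calc (M : ℝ) * (α * (2 * (1 / (4 * Q * Real.exp L))))
          ≤ (Q * Real.exp L) * (α * (2 * (1 / (4 * Q * Real.exp L)))) := by gcongr
        _ = α / 2 := by
          field_simp
          ring
    linarith
  obtain ⟨E, hE, hEs⟩ := exists_common_corruption hα (by linarith) hσ (by positivity)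
    (by positivity) s htail hmass
  have := A.isMarkov
  have hsne : s.Nonempty := Finset.card_pos.1 (hscard ▸ hMpos)
  have hsep : (s : Set (EuclideanSpace ℝ (Fin d))).Pairwise fun x y =>
      2 * (ε / (16 * √a) * (σ / (α * √L))) ≤ dist x y := by
    intro x hx y hy hxy
    obtain ⟨p, hp, rfl⟩ := Finset.mem_image.1 hx
    obtain ⟨q, hq, rfl⟩ := Finset.mem_image.1 hy
    have hpq : p ≠ q := fun h => hxy (by rw [h])
    rw [dist_smul₀, Real.norm_of_nonneg hrpos.le]
    refine le_trans ?_ (mul_le_mul_of_nonneg_left (hPsep hp hq hpq) hrpos.le)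
    have h1 : σ / (4 * α * (2 * (√a * √L))) ≤ r := by
      rw [hr]
      gcongr
    refine le_trans (le_of_eq ?_) (mul_le_mul_of_nonneg_right h1 hεpos.le)
    field_simp
    ring
  obtain ⟨β, hβ, hprob⟩ := exists_measureReal_forall_le_norm_sub
    ((Measure.pi fun _ : Fin n => E).bind A.output) hsne hsep (hscard ▸ hMge)
  obtain ⟨N, hN, hNE⟩ := hEs β hβ
  exact ⟨β, N, hN, by rw [hNE]; exact hprob⟩

/-! ### Chernoff bounds with density weights -/

section Chernoff

variable {Z : Type*} [MeasurableSpace Z]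

lemma lintegral_pi_prod_pow (E : Measure Z) [IsProbabilityMeasure E] (n : ℕ) {f : Z → ENNReal}
    (hf : Measurable f) :
    ∫⁻ z, ∏ i, f (z i) ∂(Measure.pi fun _ : Fin n => E) = (∫⁻ z, f z ∂E) ^ n := by
  have hind : iIndepFun (fun (i : Fin n) (z : Fin n → Z) => f (z i))
      (Measure.pi fun _ : Fin n => E) := iIndepFun_pi fun _ => hf.aemeasurable
  have h := lintegral_prod_eq_prod_lintegral_of_indepFun Finset.univ _ hind
    (fun i => hf.comp (measurable_pi_apply i))
  rw [h]
  have h1 : ∀ i : Fin n, ∫⁻ z, f (z i) ∂(Measure.pi fun _ : Fin n => E) = ∫⁻ z, f z ∂E :=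
    fun i => (measurePreserving_eval (fun _ : Fin n => E) i).lintegral_comp hf
  simp [h1]

/-- Chernoff bound for i.i.d. sums. -/
lemma measure_pi_le_sum_le_exp (E : Measure Z) [IsProbabilityMeasure E] (n : ℕ) {f : Z → ℝ}
    (hf : Measurable f) {a : ℝ}
    (ha : ∫⁻ z, ENNReal.ofReal (Real.exp (f z)) ∂E ≤ ENNReal.ofReal (Real.exp a)) (s : ℝ) :
    (Measure.pi fun _ : Fin n => E) {z | s ≤ ∑ i, f (z i)} ≤
      ENNReal.ofReal (Real.exp (n * a - s)) := by
  have hprod : ∀ z : Fin n → Z, ENNReal.ofReal (Real.exp (∑ i, f (z i))) =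
      ∏ i, ENNReal.ofReal (Real.exp (f (z i))) := fun z => by
    rw [Real.exp_sum, ENNReal.ofReal_prod_of_nonneg fun _ _ => (Real.exp_pos _).le]
  have hsub : {z : Fin n → Z | s ≤ ∑ i, f (z i)} ⊆ {z | ENNReal.ofReal (Real.exp s) ≤
      ∏ i, ENNReal.ofReal (Real.exp (f (z i)))} := fun z hz => by
    rw [Set.mem_ofPred_eq, ← hprod]
    exact ENNReal.ofReal_le_ofReal (Real.exp_le_exp.2 hz)
  have hmeas : Measurable fun z : Fin n → Z => ∏ i, ENNReal.ofReal (Real.exp (f (z i))) :=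
    Finset.measurable_prod _ fun i _ =>
      (Real.measurable_exp.comp (hf.comp (measurable_pi_apply i))).ennreal_ofReal
  refine (measure_mono hsub).trans ?_
  refine (meas_ge_le_lintegral_div hmeas.aemeasurable (by simp [Real.exp_pos])
    ENNReal.ofReal_ne_top).trans ?_
  rw [lintegral_pi_prod_pow E n (f := fun z => ENNReal.ofReal (Real.exp (f z))) (by fun_prop),
    Real.exp_sub, ENNReal.ofReal_div_of_pos (Real.exp_pos _), Real.exp_nat_mul,
    ENNReal.ofReal_pow (Real.exp_pos _).le]
  gcongr

/-- A measure dominated by `E` has a `[0, 1]`-valued density. -/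
lemma exists_density_of_smul_le {α : ℝ} {D E : Measure Z} [IsProbabilityMeasure D]
    [IsProbabilityMeasure E] (h : ENNReal.ofReal α • D ≤ E) :
    ∃ w : Z → ℝ, Measurable w ∧ (∀ z, 0 ≤ w z) ∧ (∀ z, w z ≤ 1) ∧
      ∀ g : Z → ENNReal, Measurable g →
        ∫⁻ z, ENNReal.ofReal (w z) * g z ∂E = ENNReal.ofReal α * ∫⁻ z, g z ∂D := by
  set μ := ENNReal.ofReal α • D with hμ
  have hfin : IsFiniteMeasure μ := Measure.smul_finite D ENNReal.ofReal_ne_top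
  -- The derivative is at most 1 only almost everywhere; truncation gives the bound at every point.
  refine ⟨fun z => min 1 (μ.rnDeriv E z).toReal,
    measurable_const.min (Measure.measurable_rnDeriv _ _).ennreal_toReal,
    fun z => le_min zero_le_one ENNReal.toReal_nonneg, fun z => min_le_left _ _, fun g hg => ?_⟩
  have hae : ∀ᵐ z ∂E, ENNReal.ofReal (min 1 (μ.rnDeriv E z).toReal) * g z
      = μ.rnDeriv E z * g z := by
    filter_upwards [Measure.rnDeriv_le_one_of_le h] with z hz
    have hz' : μ.rnDeriv E z ≤ 1 := hz
    have hne : μ.rnDeriv E z ≠ ⊤ := ne_top_of_le_ne_top ENNReal.one_ne_top hz'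
    rw [min_eq_right, ENNReal.ofReal_toReal hne]
    exact ENNReal.toReal_le_of_le_ofReal zero_le_one (by simpa using hz')
  rw [lintegral_congr_ae hae, ← smul_eq_mul, ← lintegral_smul_measure]
  exact lintegral_rnDeriv_mul (Measure.absolutelyContinuous_of_le h) hg.aemeasurable

/-- Chernoff bound for i.i.d. sums weighted by the density of `α • D`. -/
lemma measure_pi_le_weighted_sum_le_exp {α : ℝ} (hα : 0 ≤ α) (hα1 : α ≤ 1) {D E : Measure Z}
    [IsProbabilityMeasure D] [IsProbabilityMeasure E] {w : Z → ℝ} (hw : Measurable w)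
    (hw0 : ∀ z, 0 ≤ w z) (hw1 : ∀ z, w z ≤ 1)
    (hwD : ∀ g : Z → ENNReal, Measurable g →
      ∫⁻ z, ENNReal.ofReal (w z) * g z ∂E = ENNReal.ofReal α * ∫⁻ z, g z ∂D)
    (n : ℕ) {f : Z → ℝ} (hf : Measurable f) {b : ℝ} (hb : 0 ≤ b)
    (hfb : ∫⁻ z, ENNReal.ofReal (Real.exp (f z)) ∂D ≤ ENNReal.ofReal b) (s : ℝ) :
    (Measure.pi fun _ : Fin n => E) {z | s ≤ ∑ i, w (z i) * f (z i)} ≤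
      ENNReal.ofReal (Real.exp (n * (α * (b - 1)) - s)) := by
  refine measure_pi_le_sum_le_exp E n (f := fun z => w z * f z) (hw.mul hf) ?_ s
  -- Convexity lets the weight leave the exponent, so the moment under `E` is at most `1 - α + α *
  -- b`, with `b` bounding the moment under `D`.
  have hconv : ∀ z, Real.exp (w z * f z) ≤ (1 - w z) + w z * Real.exp (f z) := by
    intro z
    have := convexOn_exp.2 (Set.mem_univ 0) (Set.mem_univ (f z)) (sub_nonneg.2 (hw1 z)) (hw0 z)
      (by ring)
    simpa using this
  have hw_int : ∫⁻ z, ENNReal.ofReal (w z) ∂E = ENNReal.ofReal α := by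
    simpa using hwD (fun _ => 1) measurable_const
  have hw_int' : ∫⁻ z, ENNReal.ofReal (1 - w z) ∂E = ENNReal.ofReal (1 - α) := by
    have h1 : ∫⁻ z, ENNReal.ofReal (1 - w z) ∂E + ENNReal.ofReal α = 1 := by
      rw [← hw_int, ← lintegral_add_right _ hw.ennreal_ofReal]
      have : ∀ z, ENNReal.ofReal (1 - w z) + ENNReal.ofReal (w z) = 1 := fun z => by
        rw [← ENNReal.ofReal_add (sub_nonneg.2 (hw1 z)) (hw0 z)]
        simp
      simp [this]
    rw [ENNReal.ofReal_sub _ hα, ENNReal.ofReal_one]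
    exact ENNReal.eq_sub_of_add_eq ENNReal.ofReal_ne_top h1
  calc ∫⁻ z, ENNReal.ofReal (Real.exp (w z * f z)) ∂E
      ≤ ∫⁻ z, ENNReal.ofReal (1 - w z) +
          ENNReal.ofReal (w z) * ENNReal.ofReal (Real.exp (f z)) ∂E := by
        refine lintegral_mono fun z => ?_
        rw [← ENNReal.ofReal_mul (hw0 z), ← ENNReal.ofReal_add (sub_nonneg.2 (hw1 z))
          (mul_nonneg (hw0 z) (Real.exp_pos _).le)]
        exact ENNReal.ofReal_le_ofReal (hconv z)
    _ = ENNReal.ofReal (1 - α) +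
          ENNReal.ofReal α * ∫⁻ z, ENNReal.ofReal (Real.exp (f z)) ∂D := by
        rw [lintegral_add_left (by fun_prop), hw_int', hwD _ (by fun_prop)]
    _ ≤ ENNReal.ofReal (1 - α) + ENNReal.ofReal α * ENNReal.ofReal b := by gcongr
    _ = ENNReal.ofReal (1 - α + α * b) := by
        rw [← ENNReal.ofReal_mul hα, ENNReal.ofReal_add (by linarith) (by positivity)]
    _ ≤ ENNReal.ofReal (Real.exp (α * (b - 1))) :=
        ENNReal.ofReal_le_ofReal (by linarith [Real.add_one_le_exp (α * (b - 1))])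

end Chernoff

/-! ### From a net of the sphere to all directions -/

section Net

variable {E : Type*} [NormedAddCommGroup E] [InnerProductSpace ℝ E]

/-- A bound on a weighted quadratic form over a net of the unit sphere extends to all vectors. -/
lemma sum_mul_inner_sq_le_of_net [FiniteDimensional ℝ E] {n : ℕ} {h : Fin n → ℝ}
    (hh : ∀ i, 0 ≤ h i) (x : Fin n → E) {s : Finset E} {γ T : ℝ} (hγ : γ ≤ 1 / 2) (hT : 0 ≤ T)
    (hnet : ∀ v : E, ‖v‖ = 1 → ∃ p ∈ s, dist v p < γ)
    (hs : ∀ p ∈ s, ∑ i, h i * inner ℝ p (x i) ^ 2 ≤ T) (v : E) :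
    ∑ i, h i * inner ℝ v (x i) ^ 2 ≤ 4 * T * ‖v‖ ^ 2 := by
  -- The quadratic form is `‖A v‖ ^ 2`. Approximation by the net bounds `‖A‖` by `√T + ‖A‖ / 2`,
  -- hence by `2 * √T`.
  let A : E →L[ℝ] EuclideanSpace ℝ (Fin n) := LinearMap.toContinuousLinearMap
    ((WithLp.linearEquiv 2 ℝ (Fin n → ℝ)).symm.toLinearMap ∘ₗ
      LinearMap.pi fun i => √(h i) • innerₛₗ ℝ (x i))
  have hA : ∀ v, ‖A v‖ ^ 2 = ∑ i, h i * inner ℝ v (x i) ^ 2 := by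
    intro v
    rw [EuclideanSpace.real_norm_sq_eq]
    refine Finset.sum_congr rfl fun i _ => ?_
    have : A v i = √(h i) * inner ℝ (x i) v := rfl
    rw [this, mul_pow, Real.sq_sqrt (hh i), real_inner_comm]
  have hunit : ∀ v : E, ‖v‖ = 1 → ‖A v‖ ≤ √T + ‖A‖ / 2 := by
    intro v hv
    obtain ⟨p, hp, hvp⟩ := hnet v hv
    have h1 : ‖A p‖ ≤ √T := Real.le_sqrt_of_sq_le (by rw [hA]; exact hs p hp)
    have h2 : ‖A (v - p)‖ ≤ ‖A‖ / 2 := by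
      refine (A.le_opNorm _).trans ?_
      rw [← dist_eq_norm]
      nlinarith [norm_nonneg A]
    calc ‖A v‖ = ‖A p + A (v - p)‖ := by rw [← map_add, add_sub_cancel]
      _ ≤ _ := (norm_add_le _ _).trans (add_le_add h1 h2)
  have hop : ‖A‖ ≤ √T + ‖A‖ / 2 := by
    refine A.opNorm_le_of_unit_norm (by positivity) hunit
  have h1 : ‖A v‖ ≤ 2 * √T * ‖v‖ :=
    (A.le_opNorm v).trans (mul_le_mul_of_nonneg_right (by linarith) (norm_nonneg v))
  rw [← hA]
  calc ‖A v‖ ^ 2 ≤ (2 * √T * ‖v‖) ^ 2 := by gcongr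
    _ = 4 * T * ‖v‖ ^ 2 := by
      rw [mul_pow, mul_pow, Real.sq_sqrt hT]
      norm_num

/-- Uniform control of the weight of slabs from control over a net of the unit sphere. -/
lemma sum_mul_indicator_slab_le_of_net [FiniteDimensional ℝ E] {n : ℕ} {h : Fin n → ℝ}
    (hh : ∀ i, 0 ≤ h i) (x : Fin n → E) {s : Finset E} {γ T t B : ℝ} (hγ : γ ≤ 1 / 2)
    (hT : 0 ≤ T) (ht : 0 < t)
    (hnet : ∀ v : E, ‖v‖ = 1 → ∃ p ∈ s, dist v p < γ)
    (hs : ∀ p ∈ s, ∑ i, h i * inner ℝ p (x i) ^ 2 ≤ T)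
    (hB : ∀ p ∈ s, ∑ i, h i * Set.indicator {y | |inner ℝ p y| ≤ 2 * t} 1 (x i) ≤ B)
    {v : E} (hv : ‖v‖ = 1) :
    ∑ i, h i * Set.indicator {y | |inner ℝ v y| ≤ t} 1 (x i) ≤ B + 4 * T * γ ^ 2 / t ^ 2 := by
  obtain ⟨p, hp, hvp⟩ := hnet v hv
  -- A point of the `v`-slab outside the doubled `p`-slab has `|⟨v - p, x⟩| ≥ t`; such points are
  -- charged to the second moment, as in Chebyshev's inequality.
  have h1 : ∀ i, h i * Set.indicator {y | |inner ℝ v y| ≤ t} 1 (x i) ≤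
      h i * Set.indicator {y | |inner ℝ p y| ≤ 2 * t} 1 (x i) +
        h i * inner ℝ (v - p) (x i) ^ 2 / t ^ 2 := by
    intro i
    rw [mul_div_assoc, ← mul_add]
    refine mul_le_mul_of_nonneg_left ?_ (hh i)
    have h0 : 0 ≤ inner ℝ (v - p) (x i) ^ 2 / t ^ 2 := by positivity
    by_cases hv' : |inner ℝ v (x i)| ≤ t
    · by_cases hp' : |inner ℝ p (x i)| ≤ 2 * t
      · simpa [Set.indicator, hv', hp'] using h0
      · have h2 : t ≤ |inner ℝ (v - p) (x i)| := by
          rw [inner_sub_left, abs_sub_comm]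
          have := abs_sub_abs_le_abs_sub (inner ℝ p (x i)) (inner ℝ v (x i))
          linarith
        have h3 : t ^ 2 ≤ inner ℝ (v - p) (x i) ^ 2 :=
          sq_le_sq.2 (by rwa [abs_of_pos ht])
        simpa [Set.indicator, hv', hp'] using (one_le_div (by positivity)).2 h3
    · have h2 : 0 ≤ Set.indicator {y : E | |inner ℝ p y| ≤ 2 * t} (1 : E → ℝ) (x i) :=
        Set.indicator_nonneg (fun _ _ => zero_le_one) _
      have h3 : Set.indicator {y : E | |inner ℝ v y| ≤ t} (1 : E → ℝ) (x i) = 0 :=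
        Set.indicator_of_notMem (s := {y : E | |inner ℝ v y| ≤ t}) hv' _
      rw [h3]
      positivity
  refine (Finset.sum_le_sum fun i _ => h1 i).trans ?_
  rw [Finset.sum_add_distrib, ← Finset.sum_div]
  refine add_le_add (hB p hp) ?_
  gcongr
  refine (sum_mul_inner_sq_le_of_net hh x hγ hT hnet hs _).trans ?_
  rw [← dist_eq_norm]
  gcongr

end Net

/-! ### Greedy covering and decoding -/

/-- Greedy covering: few sets of a family suffice to leave every other set of the family with few
uncovered points. -/
lemma exists_greedy_cover {n : ℕ} (G : ℕ → Finset (Fin n)) {t : ℝ} {m : ℕ}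
    (hm : (n : ℝ) < m * t) :
    ∃ J : Fin m → ℕ, ∀ j, ((G j).filter fun i => ∀ l, i ∉ G (J l)).card < t := by
  by_contra! hcon
  have hstep : ∀ k ≤ m, ∃ J : Fin k → ℕ,
      (k : ℝ) * t ≤ (Finset.univ.filter fun i => ∃ l, i ∈ G (J l)).card := by
    intro k
    induction k with
    | zero => exact fun _ => ⟨Fin.elim0, by simp⟩
    | succ k ih =>
      intro hk
      obtain ⟨J, hJ⟩ := ih (by omega)
      obtain ⟨j, hj⟩ : ∃ j, t ≤ ((G j).filter fun i => ∀ l, i ∉ G (J l)).card := by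
        -- Only lists of length `m` are assumed bad. Padding a shorter list with index 0 can only
        -- shrink the uncovered part, so the bound passes to it.
        obtain ⟨j, hj⟩ := hcon fun l => if h : (l : ℕ) < k then J ⟨l, h⟩ else 0
        refine ⟨j, hj.trans ?_⟩
        gcongr with i
        intro hi l
        simpa using hi ⟨l, by omega⟩
      refine ⟨Fin.cons j J, ?_⟩
      have hdisj : Disjoint ((G j).filter fun i => ∀ l, i ∉ G (J l))
          (Finset.univ.filter fun i => ∃ l, i ∈ G (J l)) := by
        rw [Finset.disjoint_left]
        intro i hi hi'
        obtain ⟨l, hl⟩ := (Finset.mem_filter.1 hi').2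
        exact (Finset.mem_filter.1 hi).2 l hl
      have hsub : ((G j).filter fun i => ∀ l, i ∉ G (J l)) ∪
          (Finset.univ.filter fun i => ∃ l, i ∈ G (J l)) ⊆
          Finset.univ.filter fun i => ∃ l, i ∈ G ((Fin.cons j J : Fin (k + 1) → ℕ) l) := by
        intro i hi
        rw [Finset.mem_filter]
        refine ⟨Finset.mem_univ _, ?_⟩
        rcases Finset.mem_union.1 hi with hi | hi
        · exact ⟨0, by simpa using (Finset.mem_filter.1 hi).1⟩
        · obtain ⟨l, hl⟩ := (Finset.mem_filter.1 hi).2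
          exact ⟨l.succ, by simpa using hl⟩
      have hcard := Finset.card_le_card hsub
      rw [Finset.card_union_of_disjoint hdisj] at hcard
      have hcard' : (((G j).filter fun i => ∀ l, i ∉ G (J l)).card : ℝ) +
          ((Finset.univ.filter fun i => ∃ l, i ∈ G (J l)).card : ℝ) ≤
          (Finset.univ.filter fun i =>
            ∃ l, i ∈ G ((Fin.cons j J : Fin (k + 1) → ℕ) l)).card := by
        exact_mod_cast hcard
      push_cast
      linarith
  obtain ⟨J, hJ⟩ := hstep m le_rfl
  have h1 : ((Finset.univ.filter fun i : Fin n => ∃ l, i ∈ G (J l)).card : ℝ) ≤ n := by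
    exact_mod_cast (Finset.card_le_univ _).trans_eq (Fintype.card_fin n)
  linarith

section Decoding

variable {d : ℕ}

/-- Examples whose residual with respect to `β` is less than `B`. -/
def smallResidual (B : ℝ) (β : EuclideanSpace ℝ (Fin d)) : Set (LabeledExample d) :=
  {z | |z.2 - inner ℝ β z.1| < B}

lemma measurableSet_smallResidual (B : ℝ) (β : EuclideanSpace ℝ (Fin d)) :
    MeasurableSet (smallResidual B β) :=
  measurableSet_lt (by fun_prop) measurable_const

/-- If examples explained by `β` are heavy and slabs are light, then a list which leaves no
candidate with many unexplained examples comes close to `β`. -/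
lemma exists_norm_sub_le_of_cover {n m : ℕ} {z : Fin n → LabeledExample d} {h : Fin n → ℝ}
    (hh0 : ∀ i, 0 ≤ h i) (hh1 : ∀ i, h i ≤ 1) {q : ℕ → EuclideanSpace ℝ (Fin d)}
    (hq : DenseRange q) {B t a b s : ℝ} (hB : 0 < B) (ht : 0 < t)
    {β : EuclideanSpace ℝ (Fin d)}
    (hβ : a ≤ ∑ i, h i * (smallResidual B β).indicator 1 (z i))
    (hslab : ∀ v : EuclideanSpace ℝ (Fin d), ‖v‖ = 1 →
      ∑ i, h i * Set.indicator {y | |inner ℝ v y| ≤ t} 1 (z i).1 ≤ b)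
    {J : Fin m → ℕ}
    (hJ : ∀ j, (Set.ncard {i | z i ∈ smallResidual B (q j) ∧
      ∀ l, z i ∉ smallResidual B (q (J l))} : ℝ) < s)
    (habs : s + m * b ≤ a) :
    ∃ l, ‖q (J l) - β‖ ≤ 2 * B / t := by
  classical
  by_contra! hfar
  let U : Finset (Fin n) := Finset.univ.filter fun i =>
    z i ∈ smallResidual B β ∧ ∀ l, z i ∉ smallResidual B (q (J l))
  have hpt : ∀ i, h i * (smallResidual B β).indicator 1 (z i) ≤ (if i ∈ U then 1 else 0) +
      ∑ l, h i * Set.indicator {y | |inner ℝ (‖q (J l) - β‖⁻¹ • (q (J l) - β)) y| ≤ t} 1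
        (z i).1 := by
    intro i
    have hnn : ∀ l, 0 ≤ h i * Set.indicator
        {y | |inner ℝ (‖q (J l) - β‖⁻¹ • (q (J l) - β)) y| ≤ t} (1 : EuclideanSpace ℝ (Fin d) → ℝ)
        (z i).1 :=
      fun l => mul_nonneg (hh0 i) (Set.indicator_nonneg (fun _ _ => zero_le_one) _)
    have hsum := Finset.sum_nonneg fun l (_ : l ∈ Finset.univ) => hnn l
    by_cases hi : z i ∈ smallResidual B β
    · rw [Set.indicator_of_mem hi, Pi.one_apply, mul_one]
      by_cases hiU : i ∈ U
      · rw [if_pos hiU]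
        linarith [hh1 i]
      · obtain ⟨l, hl⟩ : ∃ l, z i ∈ smallResidual B (q (J l)) := by
          by_contra! hcon
          exact hiU (Finset.mem_filter.2 ⟨Finset.mem_univ _, hi, hcon⟩)
        rw [if_neg hiU, zero_add]
        refine le_trans ?_ (Finset.single_le_sum (fun l _ => hnn l) (Finset.mem_univ l))
        rw [Set.indicator_of_mem, Pi.one_apply, mul_one]
        have hpos : 0 < ‖q (J l) - β‖ := (div_pos (by positivity) ht).trans (hfar l)
        -- Both residuals are below `B`, so `|⟨q (J l) - β, x⟩| < 2B`; dividing by a norm above `2B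
        -- / t` puts the point in the slab.
        rw [Set.mem_ofPred_eq, real_inner_smul_left, abs_mul, abs_of_pos (inv_pos.2 hpos),
          inv_mul_le_iff₀ hpos, inner_sub_left]
        have h1 : |(z i).2 - inner ℝ β (z i).1| < B := hi
        have h2 : |(z i).2 - inner ℝ (q (J l)) (z i).1| < B := hl
        have h3 := abs_sub_le (inner ℝ (q (J l)) (z i).1) (z i).2 (inner ℝ β (z i).1)
        rw [abs_sub_comm _ (z i).2] at h3
        have h4 := (div_lt_iff₀ ht).1 (hfar l)
        linarith
    · rw [Set.indicator_of_notMem hi, mul_zero]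
      positivity
  have h1 : a ≤ U.card + m * b := by
    refine hβ.trans ((Finset.sum_le_sum fun i _ => hpt i).trans ?_)
    rw [Finset.sum_add_distrib, Finset.sum_comm]
    refine add_le_add (by simp) ?_
    calc _ ≤ ∑ _l : Fin m, b := Finset.sum_le_sum fun l _ => hslab _ ?_
      _ = m * b := by simp
    have hpos : 0 < ‖q (J l) - β‖ := (div_pos (by positivity) ht).trans (hfar l)
    rw [norm_smul, norm_inv, norm_norm, inv_mul_cancel₀ hpos.ne']
  -- `β` need not be a candidate. Explaining the finitely many examples of `U` is an open condition,
  -- so some candidate explains them as well.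
  have hopen : IsOpen {β' : EuclideanSpace ℝ (Fin d) | ∀ i ∈ U, z i ∈ smallResidual B β'} := by
    have : {β' : EuclideanSpace ℝ (Fin d) | ∀ i ∈ U, z i ∈ smallResidual B β'} =
        ⋂ i ∈ U, {β' | |(z i).2 - inner ℝ β' (z i).1| < B} := by
      ext β'
      simp [smallResidual]
    rw [this]
    exact isOpen_biInter_finset fun i _ => isOpen_lt (by fun_prop) continuous_const
  obtain ⟨j, hj⟩ := hq.exists_mem_open hopen ⟨β, fun i hi => (Finset.mem_filter.1 hi).2.1⟩
  have h2 : U.card ≤ Set.ncard {i | z i ∈ smallResidual B (q j) ∧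
      ∀ l, z i ∉ smallResidual B (q (J l))} := by
    rw [← Set.ncard_coe_finset]
    exact Set.ncard_le_ncard fun i hi => ⟨hj i hi, (Finset.mem_filter.1 hi).2.2⟩
  have h3 : (U.card : ℝ) ≤ Set.ncard {i | z i ∈ smallResidual B (q j) ∧
      ∀ l, z i ∉ smallResidual B (q (J l))} := by exact_mod_cast h2
  linarith [hJ j]

/-- A measurable choice of indices which leaves no candidate with many unexplained examples. -/
lemma exists_measurable_cover (n m : ℕ) (q : ℕ → EuclideanSpace ℝ (Fin d)) (B : ℝ) {s : ℝ}
    (hm : (n : ℝ) < m * s) :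
    ∃ J : (Fin n → LabeledExample d) → Fin m → ℕ, Measurable J ∧ ∀ z j,
      (Set.ncard {i | z i ∈ smallResidual B (q j) ∧
        ∀ l, z i ∉ smallResidual B (q (J z l))} : ℝ) < s := by
  classical
  -- Index lists are countable, so taking the first valid one in an enumeration is a measurable
  -- choice.
  obtain ⟨e, he⟩ := exists_surjective_nat (Fin m → ℕ)
  let p : (Fin n → LabeledExample d) → ℕ → Prop := fun z k => ∀ j,
    (Set.ncard {i | z i ∈ smallResidual B (q j) ∧
      ∀ l, z i ∉ smallResidual B (q (e k l))} : ℝ) < s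
  have hp : ∀ z, ∃ k, p z k := by
    intro z
    obtain ⟨J, hJ⟩ := exists_greedy_cover
      (fun j => Finset.univ.filter fun i => z i ∈ smallResidual B (q j)) hm
    obtain ⟨k, rfl⟩ := he J
    refine ⟨k, fun j => lt_of_eq_of_lt ?_ (hJ j)⟩
    rw [← Set.ncard_coe_finset]
    congr 2
    ext i
    simp
  have hpm : ∀ k, MeasurableSet {z | p z k} := by
    intro k
    simp only [p, Set.ofPred_forall]
    refine MeasurableSet.iInter fun j => ?_
    have hc : ∀ z : Fin n → LabeledExample d, (Set.ncard {i | z i ∈ smallResidual B (q j) ∧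
        ∀ l, z i ∉ smallResidual B (q (e k l))} : ℝ) =
        ∑ i, (smallResidual B (q j) ∩ ⋂ l, (smallResidual B (q (e k l)))ᶜ).indicator 1 (z i) := by
      intro z
      simp only [Set.indicator_apply, Pi.one_apply, Finset.sum_boole]
      rw [← Set.ncard_coe_finset]
      congr 2
      ext i
      simp
    simp only [hc]
    refine measurableSet_lt (Finset.measurable_sum _ fun i _ => ?_) measurable_const
    exact (measurable_one.indicator ((measurableSet_smallResidual _ _).inter
      (MeasurableSet.iInter fun l => (measurableSet_smallResidual _ _).compl))).comp
      (measurable_pi_apply i)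
  refine ⟨fun z => e (Nat.find (hp z)), ?_, fun z => Nat.find_spec (hp z)⟩
  exact (measurable_of_countable e).comp (measurable_find hp hpm)

end Decoding

/-! ### Concentration for corrupted regression samples -/

section Regression

variable {d : ℕ}

lemma isProbabilityMeasure_corrupted {α : ℝ} (hα : 0 ≤ α) (hα1 : α ≤ 1)
    (D N : Measure (LabeledExample d)) [IsProbabilityMeasure D] [IsProbabilityMeasure N] :
    IsProbabilityMeasure (corrupted α D N) := ⟨by
  simp only [corrupted, Measure.add_apply, Measure.smul_apply, measure_univ, smul_eq_mul, mul_one]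
  rw [← ENNReal.ofReal_add hα (by linarith)]
  simp⟩

lemma gaussianLinearRegression_compl_smallResidual_le {σ : ℝ} (hσ : 0 < σ)
    (β : EuclideanSpace ℝ (Fin d)) :
    gaussianLinearRegression σ β (smallResidual (2 * σ) β)ᶜ ≤ ENNReal.ofReal (1 / 4) := by
  rw [gaussianLinearRegression, Measure.map_apply (by fun_prop)
    (measurableSet_smallResidual _ _).compl]
  have hpre : (fun p : EuclideanSpace ℝ (Fin d) × ℝ => (p.1, inner ℝ β p.1 + p.2)) ⁻¹'
      (smallResidual (2 * σ) β)ᶜ = Prod.snd ⁻¹' {e : ℝ | 2 * σ ≤ |e|} := by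
    ext p
    simp [smallResidual]
  have hmeas : MeasurableSet {e : ℝ | 2 * σ ≤ |e|} :=
    measurableSet_le measurable_const (by fun_prop)
  rw [hpre, ← Measure.map_apply measurable_snd hmeas, Measure.map_snd_prod, measure_univ, one_smul]
  have h := meas_ge_le_variance_div_sq
    (memLp_id_gaussianReal (μ := 0) (v := (σ ^ 2).toNNReal) 2) (by positivity : 0 < 2 * σ)
  rw [variance_id_gaussianReal, Real.coe_toNNReal _ (sq_nonneg σ)] at h
  simp only [id, integral_id_gaussianReal, sub_zero] at h
  refine h.trans (le_of_eq ?_)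
  congr 1
  field_simp
  norm_num

/-- Weighted count of the examples with small residual. -/
lemma measure_pi_weighted_smallResidual_le {α σ : ℝ} (hα : 0 ≤ α) (hα1 : α ≤ 1) (hσ : 0 < σ)
    (β : EuclideanSpace ℝ (Fin d)) {E : Measure (LabeledExample d)} [IsProbabilityMeasure E]
    {w : LabeledExample d → ℝ} (hw : Measurable w) (hw0 : ∀ z, 0 ≤ w z) (hw1 : ∀ z, w z ≤ 1)
    (hwD : ∀ g : LabeledExample d → ENNReal, Measurable g → ∫⁻ z, ENNReal.ofReal (w z) * g z ∂E =
      ENNReal.ofReal α * ∫⁻ z, g z ∂(gaussianLinearRegression σ β)) (n : ℕ) :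
    (Measure.pi fun _ : Fin n => E) {z | ∑ i, w (z i) * (smallResidual (2 * σ) β).indicator 1 (z i)
      ≤ α * n / 8} ≤ ENNReal.ofReal (Real.exp (-(α * n / 4))) := by
  have hS := measurableSet_smallResidual (2 * σ) β
  have hexp : Real.exp (-2) ≤ 1 / 4 := by
    rw [Real.exp_neg, inv_le_comm₀ (Real.exp_pos _) (by norm_num)]
    have h1 := Real.add_one_le_exp (1 : ℝ)
    have h2 : Real.exp 2 = Real.exp 1 * Real.exp 1 := by
      rw [← Real.exp_add]
      norm_num
    nlinarith
  have hb : ∫⁻ z, ENNReal.ofReal (Real.exp (-2 * (smallResidual (2 * σ) β).indicator 1 z))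
      ∂(gaussianLinearRegression σ β) ≤ ENNReal.ofReal (1 / 2) := by
    calc _ ≤ ∫⁻ z, ENNReal.ofReal (1 / 4) + (smallResidual (2 * σ) β)ᶜ.indicator 1 z
          ∂(gaussianLinearRegression σ β) := by
          refine lintegral_mono fun z => ?_
          by_cases hz : z ∈ smallResidual (2 * σ) β
          · simpa [hz] using ENNReal.ofReal_le_ofReal hexp
          · simp [hz]
      _ ≤ ENNReal.ofReal (1 / 4) + ENNReal.ofReal (1 / 4) := by
          rw [lintegral_add_left measurable_const, lintegral_const, measure_univ, mul_one,
            lintegral_indicator_one hS.compl]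
          gcongr
          exact gaussianLinearRegression_compl_smallResidual_le hσ β
      _ = ENNReal.ofReal (1 / 2) := by
          rw [← ENNReal.ofReal_add (by norm_num) (by norm_num)]
          norm_num
  have h := measure_pi_le_weighted_sum_le_exp hα hα1 hw hw0 hw1 hwD n
    (f := fun z => -2 * (smallResidual (2 * σ) β).indicator 1 z)
    ((measurable_one.indicator hS).const_mul _) (by norm_num) hb (-(α * n / 4))
  refine (measure_mono fun z hz => ?_).trans (h.trans (le_of_eq ?_))
  · rw [Set.mem_ofPred_eq] at hz ⊢
    have h2 : ∀ i, w (z i) * (-2 * (smallResidual (2 * σ) β).indicator 1 (z i)) =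
        -2 * (w (z i) * (smallResidual (2 * σ) β).indicator 1 (z i)) := fun i => by ring
    simp only [h2, ← Finset.mul_sum]
    linarith
  · congr 2
    ring

/-- Weighted count of the examples in a thin slab. -/
lemma measure_pi_weighted_slab_le {α σ lam : ℝ} (hα : 0 ≤ α) (hα1 : α ≤ 1) (hlam : 0 < lam)
    (β : EuclideanSpace ℝ (Fin d)) {E : Measure (LabeledExample d)} [IsProbabilityMeasure E]
    {w : LabeledExample d → ℝ} (hw : Measurable w) (hw0 : ∀ z, 0 ≤ w z) (hw1 : ∀ z, w z ≤ 1)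
    (hwD : ∀ g : LabeledExample d → ENNReal, Measurable g → ∫⁻ z, ENNReal.ofReal (w z) * g z ∂E =
      ENNReal.ofReal α * ∫⁻ z, g z ∂(gaussianLinearRegression σ β)) (n : ℕ)
    {u : EuclideanSpace ℝ (Fin d)} (hu : ‖u‖ = 1) :
    (Measure.pi fun _ : Fin n => E) {z | α ^ 2 * n / lam ≤ ∑ i, w (z i) *
      Set.indicator {y | |inner ℝ u y| ≤ 2 * (Real.exp (-lam) / 4 * α)} 1 (z i).1} ≤
      ENNReal.ofReal (Real.exp (-(α ^ 2 * n / 2))) := by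
  set S : Set (EuclideanSpace ℝ (Fin d)) :=
    {y | |inner ℝ u y| ≤ 2 * (Real.exp (-lam) / 4 * α)} with hS_def
  have hS : MeasurableSet S := measurableSet_le (by fun_prop) measurable_const
  have hS' : MeasurableSet (Prod.fst ⁻¹' S : Set (LabeledExample d)) := hS.preimage measurable_fst
  -- The factor `exp (-lam)` in the slab width offsets the growth `exp lam`; a large `lam` then
  -- makes the weight bound `α² n / lam` small.
  have hb : ∫⁻ z, ENNReal.ofReal (Real.exp (lam * S.indicator 1 z.1))
      ∂(gaussianLinearRegression σ β) ≤ ENNReal.ofReal (1 + α / 2) := by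
    calc _ ≤ ∫⁻ z, 1 + ENNReal.ofReal (Real.exp lam) * (Prod.fst ⁻¹' S).indicator 1 z
          ∂(gaussianLinearRegression σ β) := by
          refine lintegral_mono fun z => ?_
          by_cases hz : z.1 ∈ S
          · simp [Set.indicator, hz]
          · simp [Set.indicator, hz]
      _ ≤ 1 + ENNReal.ofReal (Real.exp lam) *
          ENNReal.ofReal (2 * (Real.exp (-lam) / 4 * α)) := by
          rw [lintegral_add_left measurable_const, lintegral_const, measure_univ, mul_one,
            lintegral_const_mul _ (measurable_one.indicator hS'), lintegral_indicator_one hS',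
            gaussianLinearRegression_fst_preimage σ β hS]
          gcongr
          exact stdGaussian_abs_inner_le_le hu _
      _ = ENNReal.ofReal (1 + α / 2) := by
          rw [← ENNReal.ofReal_mul (Real.exp_pos _).le, ← ENNReal.ofReal_one,
            ← ENNReal.ofReal_add zero_le_one (by positivity), Real.exp_neg]
          congr 1
          field_simp
          ring
  have h := measure_pi_le_weighted_sum_le_exp hα hα1 hw hw0 hw1 hwD n
    (f := fun z => lam * S.indicator 1 z.1)
    (((measurable_one.indicator hS).comp measurable_fst).const_mul _) (by positivity) hb
    (α ^ 2 * n)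
  refine (measure_mono fun z hz => ?_).trans (h.trans (le_of_eq ?_))
  · rw [Set.mem_ofPred_eq] at hz ⊢
    have h2 : ∀ i, w (z i) * (lam * S.indicator 1 (z i).1) =
        lam * (w (z i) * S.indicator 1 (z i).1) := fun i => by ring
    simp only [h2, ← Finset.mul_sum]
    rwa [div_le_iff₀' hlam] at hz
  · congr 2
    ring

/-- Weighted second moment in a direction. -/
lemma measure_pi_weighted_sq_le {α σ : ℝ} (hα : 0 ≤ α) (hα1 : α ≤ 1)
    (β : EuclideanSpace ℝ (Fin d)) {E : Measure (LabeledExample d)} [IsProbabilityMeasure E]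
    {w : LabeledExample d → ℝ} (hw : Measurable w) (hw0 : ∀ z, 0 ≤ w z) (hw1 : ∀ z, w z ≤ 1)
    (hwD : ∀ g : LabeledExample d → ENNReal, Measurable g → ∫⁻ z, ENNReal.ofReal (w z) * g z ∂E =
      ENNReal.ofReal α * ∫⁻ z, g z ∂(gaussianLinearRegression σ β)) (n : ℕ)
    {u : EuclideanSpace ℝ (Fin d)} (hu : ‖u‖ ≤ 1) :
    (Measure.pi fun _ : Fin n => E) {z | 8 * (α * n) ≤ ∑ i, w (z i) * inner ℝ u (z i).1 ^ 2} ≤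
      ENNReal.ofReal (Real.exp (-(α * n))) := by
  have hb : ∫⁻ z, ENNReal.ofReal (Real.exp (inner ℝ u z.1 ^ 2 / 4))
      ∂(gaussianLinearRegression σ β) ≤ ENNReal.ofReal 2 := by
    rw [lintegral_gaussianLinearRegression σ β (by fun_prop)]
    simpa using lintegral_exp_inner_sq_stdGaussian hu
  have h := measure_pi_le_weighted_sum_le_exp hα hα1 hw hw0 hw1 hwD n
    (f := fun z => inner ℝ u z.1 ^ 2 / 4) (by fun_prop) (by norm_num) hb (2 * (α * n))
  refine (measure_mono fun z hz => ?_).trans (h.trans (le_of_eq ?_))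
  · rw [Set.mem_ofPred_eq] at hz ⊢
    simp only [← mul_div_assoc, ← Finset.sum_div]
    linarith
  · congr 2
    ring

/-- For samples from a corrupted regression model the weighted examples have many small residuals
and, uniformly over all directions, few points in thin slabs. -/
lemma measure_pi_regular_sample_compl_le {α σ : ℝ} (hα : 0 < α) (hα2 : α < 1 / 2) (hσ : 0 < σ)
    (β : EuclideanSpace ℝ (Fin d)) {E : Measure (LabeledExample d)} [IsProbabilityMeasure E]
    {w : LabeledExample d → ℝ} (hw : Measurable w) (hw0 : ∀ z, 0 ≤ w z) (hw1 : ∀ z, w z ≤ 1)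
    (hwD : ∀ g : LabeledExample d → ENNReal, Measurable g → ∫⁻ z, ENNReal.ofReal (w z) * g z ∂E =
      ENNReal.ofReal α * ∫⁻ z, g z ∂(gaussianLinearRegression σ β)) (n : ℕ) :
    (Measure.pi fun _ : Fin n => E) {z |
      α * n / 8 ≤ ∑ i, w (z i) * (smallResidual (2 * σ) β).indicator 1 (z i) ∧
      ∀ v : EuclideanSpace ℝ (Fin d), ‖v‖ = 1 → ∑ i, w (z i) *
        Set.indicator {y | |inner ℝ v y| ≤ Real.exp (-1024) / 4 * α} 1 (z i).1 ≤
          α ^ 2 * n / 512}ᶜ ≤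
      ENNReal.ofReal (3 * (768 / (Real.exp (-1024) / 4 * α ^ 2)) ^ d *
        Real.exp (-(α ^ 2 * n / 2))) := by
  set κ : ℝ := Real.exp (-1024) / 4 with hκ
  have hκpos : 0 < κ := by positivity
  have hκ1 : κ ≤ 1 := by
    have : Real.exp (-1024) ≤ 1 := Real.exp_le_one_iff.2 (by norm_num)
    linarith
  set γ : ℝ := κ * α ^ 2 / 256 with hγ
  have hγpos : 0 < γ := by positivity
  have hα21 : α ^ 2 ≤ 1 := by nlinarith
  have hγ2 : γ ≤ 1 / 2 := by
    have : κ * α ^ 2 ≤ 1 := mul_le_one₀ hκ1 (by positivity) hα21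
    rw [hγ]
    linarith
  obtain ⟨s, hs, -, hnet, hcard⟩ := exists_separated_net
    (A := Metric.sphere (0 : EuclideanSpace ℝ (Fin d)) 1) Metric.sphere_subset_closedBall hγpos
    (by linarith)
  rw [finrank_euclideanSpace_fin] at hcard
  have hγ3 : 3 / γ = 768 / (κ * α ^ 2) := by
    rw [hγ]
    field_simp
    norm_num
  rw [hγ3] at hcard
  have hunit : ∀ p ∈ s, ‖p‖ = 1 := fun p hp => by simpa using hs hp
  have hnet' : ∀ v : EuclideanSpace ℝ (Fin d), ‖v‖ = 1 → ∃ p ∈ s, dist v p < γ :=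
    fun v hv => hnet v (by simpa using hv)
  set P : Measure (Fin n → LabeledExample d) := Measure.pi fun _ : Fin n => E
  set B₁ : Set (Fin n → LabeledExample d) :=
    {z | ∑ i, w (z i) * (smallResidual (2 * σ) β).indicator 1 (z i) ≤ α * n / 8} with hB₁
  set B₂ : EuclideanSpace ℝ (Fin d) → Set (Fin n → LabeledExample d) := fun p =>
    {z | α ^ 2 * n / 1024 ≤ ∑ i, w (z i) *
      Set.indicator {y | |inner ℝ p y| ≤ 2 * (κ * α)} 1 (z i).1} with hB₂
  set B₃ : EuclideanSpace ℝ (Fin d) → Set (Fin n → LabeledExample d) := fun p =>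
    {z | 8 * (α * n) ≤ ∑ i, w (z i) * inner ℝ p (z i).1 ^ 2} with hB₃
  set δ : ℝ := Real.exp (-(α ^ 2 * n / 2)) with hδ
  have hn : (0 : ℝ) ≤ n := Nat.cast_nonneg n
  have hαα : α ^ 2 * n / 2 ≤ α * n / 4 := by
    have : α ^ 2 ≤ α * (1 / 2) := by nlinarith
    nlinarith
  have h1 : P B₁ ≤ ENNReal.ofReal δ :=
    (measure_pi_weighted_smallResidual_le hα.le (by linarith) hσ β hw hw0 hw1 hwD n).trans
      (ENNReal.ofReal_le_ofReal (Real.exp_le_exp.2 (by linarith)))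
  have h2 : ∀ p ∈ s, P (B₂ p) ≤ ENNReal.ofReal δ := fun p hp =>
    measure_pi_weighted_slab_le hα.le (by linarith) (by norm_num) β hw hw0 hw1 hwD n (hunit p hp)
  have h3 : ∀ p ∈ s, P (B₃ p) ≤ ENNReal.ofReal δ := fun p hp =>
    (measure_pi_weighted_sq_le hα.le (by linarith) β hw hw0 hw1 hwD n (hunit p hp).le).trans
      (ENNReal.ofReal_le_ofReal (Real.exp_le_exp.2 (by nlinarith [mul_nonneg hα.le hn])))
  have hsub : {z : Fin n → LabeledExample d |
      α * n / 8 ≤ ∑ i, w (z i) * (smallResidual (2 * σ) β).indicator 1 (z i) ∧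
      ∀ v : EuclideanSpace ℝ (Fin d), ‖v‖ = 1 → ∑ i, w (z i) *
        Set.indicator {y | |inner ℝ v y| ≤ κ * α} 1 (z i).1 ≤ α ^ 2 * n / 512}ᶜ ⊆
      B₁ ∪ ⋃ p ∈ s, (B₂ p ∪ B₃ p) := by
    intro z hz
    by_contra hcon
    simp only [Set.mem_union, Set.mem_iUnion, not_or, not_exists] at hcon
    obtain ⟨hz1, hz2⟩ := hcon
    refine hz ⟨(not_le.1 hz1).le, fun v hv => ?_⟩
    have hkey := sum_mul_indicator_slab_le_of_net (fun i => hw0 (z i)) (fun i => (z i).1) hγ2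
      (by positivity : 0 ≤ 8 * (α * n)) (by positivity : 0 < κ * α) hnet'
      (fun p hp => (not_le.1 (hz2 p hp).2).le) (fun p hp => (not_le.1 (hz2 p hp).1).le) hv
    refine hkey.trans ?_
    have h4 : 4 * (8 * (α * n)) * γ ^ 2 / (κ * α) ^ 2 = α ^ 2 * n * (α / 2048) := by
      rw [hγ]
      field_simp
      ring
    rw [h4]
    nlinarith [mul_nonneg (sq_nonneg α) hn]
  have hone : (1 : ℝ) ≤ (768 / (κ * α ^ 2)) ^ d := by
    refine one_le_pow₀ ((one_le_div (by positivity)).2 ?_)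
    have : κ * α ^ 2 ≤ 1 := mul_le_one₀ hκ1 (by positivity) hα21
    linarith
  calc P _ ≤ P (B₁ ∪ ⋃ p ∈ s, (B₂ p ∪ B₃ p)) := measure_mono hsub
    _ ≤ P B₁ + ∑ p ∈ s, (P (B₂ p) + P (B₃ p)) := by
        refine (measure_union_le _ _).trans ?_
        gcongr
        refine (measure_biUnion_finset_le _ _).trans (Finset.sum_le_sum fun p _ => ?_)
        exact measure_union_le _ _
    _ ≤ ENNReal.ofReal δ + ∑ p ∈ s, (ENNReal.ofReal δ + ENNReal.ofReal δ) := by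
        gcongr with p hp
        · exact h2 p hp
        · exact h3 p hp
    _ = ENNReal.ofReal (δ + s.card * (δ + δ)) := by
        rw [Finset.sum_const, nsmul_eq_mul, ← ENNReal.ofReal_add (by positivity) (by positivity),
          ← ENNReal.ofReal_natCast, ← ENNReal.ofReal_mul (by positivity),
          ← ENNReal.ofReal_add (by positivity) (by positivity)]
    _ ≤ _ := by
        refine ENNReal.ofReal_le_ofReal ?_
        have hδpos : 0 < δ := Real.exp_pos _
        nlinarith

end Regression

/-! ### Sample size and the upper bound -/

/-- The sample size makes the union bound over the net effective. -/
lemma net_union_bound_le {d : ℕ} {κ α τ x : ℝ} (hκ : 0 < κ) (hκ1 : κ ≤ 768) (hα : 0 < α)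
    (hα1 : α ≤ 1) (hτ : 0 < τ) (hτ1 : τ < 1) (hd : (1 : ℝ) ≤ d)
    (hx : 2 * (Real.log (768 / κ) + 4) * (d + Real.log (1 / τ)) / α ^ 3 ≤ x) :
    3 * (768 / (κ * α ^ 2)) ^ d * Real.exp (-(α ^ 2 * x / 2)) ≤ τ := by
  set a₀ : ℝ := Real.log (768 / κ) with ha₀
  have ha₀pos : 0 ≤ a₀ := Real.log_nonneg ((one_le_div hκ).2 hκ1)
  have hlogτ : 0 < Real.log (1 / τ) := Real.log_pos ((one_lt_div hτ).2 hτ1)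
  have h1 : 768 / (κ * α ^ 2) = Real.exp (a₀ + 2 * Real.log (1 / α)) := by
    rw [Real.exp_add, ha₀, Real.exp_log (by positivity), two_mul, Real.exp_add,
      Real.exp_log (by positivity)]
    field_simp
  -- The net needs `α² n` of order `d log(1/α)`; this crude bound on the logarithm leads to the
  -- third power of `α`.
  have h2 : Real.log (1 / α) ≤ 1 / α := (Real.log_le_sub_one_of_pos (by positivity)).trans
    (by linarith)
  have h3 : (3 : ℝ) ≤ Real.exp 2 := by linarith [Real.add_one_le_exp (2 : ℝ)]
  have h4 : τ = Real.exp (-Real.log (1 / τ)) := by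
    rw [one_div, Real.log_inv, neg_neg, Real.exp_log hτ]
  have h5 : 1 ≤ 1 / α := (one_le_div hα).2 (by linarith)
  have h6 : 2 * (a₀ + 4) * (d + Real.log (1 / τ)) * (1 / α) / 2 ≤ α ^ 2 * x / 2 := by
    have : α ^ 2 * (2 * (a₀ + 4) * (d + Real.log (1 / τ)) / α ^ 3) ≤ α ^ 2 * x :=
      mul_le_mul_of_nonneg_left hx (sq_nonneg α)
    have h7 : α ^ 2 * (2 * (a₀ + 4) * (d + Real.log (1 / τ)) / α ^ 3) =
        2 * (a₀ + 4) * (d + Real.log (1 / τ)) * (1 / α) := by field_simp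
    linarith
  rw [h1, ← Real.exp_nat_mul]
  calc 3 * Real.exp (d * (a₀ + 2 * Real.log (1 / α))) * Real.exp (-(α ^ 2 * x / 2))
      ≤ Real.exp 2 * Real.exp (d * (a₀ + 2 * Real.log (1 / α))) *
        Real.exp (-(α ^ 2 * x / 2)) := by gcongr
    _ = Real.exp (2 + d * (a₀ + 2 * Real.log (1 / α)) + -(α ^ 2 * x / 2)) := by
        rw [Real.exp_add, Real.exp_add]
    _ ≤ Real.exp (-Real.log (1 / τ)) := by
        refine Real.exp_le_exp.2 ?_
        have e1 : (d : ℝ) * (a₀ + 2 * Real.log (1 / α)) ≤ d * ((a₀ + 2) * (1 / α)) := by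
          gcongr
          nlinarith
        have e2 : (2 : ℝ) ≤ 2 * (d * (1 / α)) := by nlinarith
        have e3 : Real.log (1 / τ) ≤ (a₀ + 4) * (Real.log (1 / τ) * (1 / α)) := by
          have : Real.log (1 / τ) ≤ Real.log (1 / τ) * (1 / α) :=
            le_mul_of_one_le_right hlogτ.le h5
          nlinarith
        have e4 : 2 * (a₀ + 4) * (d + Real.log (1 / τ)) * (1 / α) / 2 =
            (a₀ + 4) * (d * (1 / α)) + (a₀ + 4) * (Real.log (1 / τ) * (1 / α)) := by
          ring
        nlinarith
    _ = τ := h4.symm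

/-- Upper bound on the error of list decoding. -/
lemma listDecoder_upper_bound :
    ∃ C : ℝ, 0 < C ∧
      ∀ (d : ℕ) (α σ τ : ℝ), 0 < d → 0 < α → α < 1 / 2 → 0 < σ → 0 < τ → τ < 1 →
        ∃ (n m : ℕ) (A : ListDecoder d n m),
          (n : ℝ) ≤ C * ((d : ℝ) + Real.log (1 / τ)) / α ^ 3 ∧
          (m : ℝ) ≤ C / α ∧
          ∀ (β : EuclideanSpace ℝ (Fin d)) (N : Measure (LabeledExample d)),
            IsProbabilityMeasure N →
            1 - τ ≤ A.prob (corrupted α (gaussianLinearRegression σ β) N)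
              {l | ∃ i, ‖l i - β‖ ≤ C * (σ / α)} := by
  set κ : ℝ := Real.exp (-1024) / 4 with hκ
  have hκpos : 0 < κ := by positivity
  have hκ1 : κ ≤ 1 := by
    have : Real.exp (-1024) ≤ 1 := Real.exp_le_one_iff.2 (by norm_num)
    linarith
  set a₀ : ℝ := Real.log (768 / κ) with ha₀
  have ha₀pos : 0 ≤ a₀ := Real.log_nonneg ((one_le_div hκpos).2 (by linarith))
  set C₀ : ℝ := 2 * (a₀ + 4) with hC₀
  refine ⟨2 * C₀ + 17 + 4 / κ, by positivity, ?_⟩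
  set C : ℝ := 2 * C₀ + 17 + 4 / κ with hC
  have hCκ : 4 / κ ≤ C := by linarith
  have hC17 : 17 ≤ C := by
    have : 0 < 4 / κ := by positivity
    linarith
  have hC2 : 2 * C₀ ≤ C := by
    have : 0 < 4 / κ := by positivity
    linarith
  intro d α σ τ hd hα hα2 hσ hτ hτ1
  have hd1 : (1 : ℝ) ≤ d := by exact_mod_cast hd
  have hlogτ : 0 < Real.log (1 / τ) := Real.log_pos ((one_lt_div hτ).2 hτ1)
  set D : ℝ := d + Real.log (1 / τ) with hD
  have hD1 : 1 ≤ D := by linarith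
  set n : ℕ := ⌈C₀ * D / α ^ 3⌉₊ with hn
  -- Strictly more than `16 / α`, as the greedy cover with threshold `α n / 16` requires.
  set m : ℕ := ⌊16 / α⌋₊ + 1 with hm
  have hα3 : α ^ 3 ≤ 1 := pow_le_one₀ hα.le (by linarith)
  have hX1 : 1 ≤ C₀ * D / α ^ 3 := by
    rw [le_div_iff₀ (by positivity)]
    nlinarith
  have hnge : C₀ * D / α ^ 3 ≤ n := Nat.le_ceil _
  have hnle : (n : ℝ) ≤ C * D / α ^ 3 := by
    have h1 : (n : ℝ) < C₀ * D / α ^ 3 + 1 := Nat.ceil_lt_add_one (by linarith)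
    calc (n : ℝ) ≤ 2 * C₀ * D / α ^ 3 := by
          rw [mul_assoc, mul_div_assoc]
          linarith
      _ ≤ _ := by gcongr
  have hnpos : (0 : ℝ) < n := by linarith
  have hmle : (m : ℝ) ≤ 17 / α := by
    have h1 : (⌊16 / α⌋₊ : ℝ) ≤ 16 / α := Nat.floor_le (by positivity)
    have h2 : 1 ≤ 1 / α := (one_le_div hα).2 (by linarith)
    have h3 : 17 / α = 16 / α + 1 / α := by ring
    rw [hm]
    push_cast
    linarith
  have hmgt : 16 / α < m := by
    rw [hm]
    push_cast
    exact Nat.lt_floor_add_one _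
  have hcover : (n : ℝ) < m * (α * n / 16) := by
    rw [div_lt_iff₀ hα] at hmgt
    nlinarith
  obtain ⟨J, hJm, hJ⟩ := exists_measurable_cover n m
    (TopologicalSpace.denseSeq (EuclideanSpace ℝ (Fin d))) (2 * σ) hcover
  set q := TopologicalSpace.denseSeq (EuclideanSpace ℝ (Fin d)) with hq
  have hFm : Measurable fun z l => q (J z l) :=
    (measurable_of_countable fun (j : Fin m → ℕ) (l : Fin m) => q (j l)).comp hJm
  refine ⟨n, m, ⟨Kernel.deterministic _ hFm, inferInstance⟩, hnle,
    hmle.trans (by gcongr), fun β N hN => ?_⟩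
  have hE := isProbabilityMeasure_corrupted hα.le (by linarith) (gaussianLinearRegression σ β) N
  set E := corrupted α (gaussianLinearRegression σ β) N with hE_def
  have hle : ENNReal.ofReal α • gaussianLinearRegression σ β ≤ E := Measure.le_add_right le_rfl
  -- The weight depends on `β` and `N`, but it enters only the analysis, not the decoder.
  obtain ⟨w, hw, hw0, hw1, hwD⟩ := exists_density_of_smul_le hle
  have hfail := measure_pi_regular_sample_compl_le hα hα2 hσ β hw hw0 hw1 hwD n
  have hτle : 3 * (768 / (κ * α ^ 2)) ^ d * Real.exp (-(α ^ 2 * n / 2)) ≤ τ :=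
    net_union_bound_le hκpos (by linarith) hα (by linarith) hτ hτ1 hd1 hnge
  have hS : MeasurableSet {l : Fin m → EuclideanSpace ℝ (Fin d) |
      ∃ i, ‖l i - β‖ ≤ C * (σ / α)} := by
    rw [Set.ofPred_exists]
    exact MeasurableSet.iUnion fun i => measurableSet_le (by fun_prop) measurable_const
  have hbind : (Measure.pi fun _ : Fin n => E).bind (Kernel.deterministic _ hFm) =
      (Measure.pi fun _ : Fin n => E).map fun z l => q (J z l) :=
    Measure.deterministic_comp_eq_map hFm
  rw [ListDecoder.prob, hbind, measureReal_def, Measure.map_apply hFm hS, ← measureReal_def]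
  have hpre := hS.preimage hFm
  have hcompl := probReal_compl_eq_one_sub hpre (μ := Measure.pi fun _ : Fin n => E)
  have hsub : ((fun z l => q (J z l)) ⁻¹' {l : Fin m → EuclideanSpace ℝ (Fin d) |
      ∃ i, ‖l i - β‖ ≤ C * (σ / α)})ᶜ ⊆ {z : Fin n → LabeledExample d |
      α * n / 8 ≤ ∑ i, w (z i) * (smallResidual (2 * σ) β).indicator 1 (z i) ∧
      ∀ v : EuclideanSpace ℝ (Fin d), ‖v‖ = 1 → ∑ i, w (z i) *
        Set.indicator {y | |inner ℝ v y| ≤ Real.exp (-1024) / 4 * α} 1 (z i).1 ≤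
          α ^ 2 * n / 512}ᶜ := by
    refine Set.compl_subset_compl.2 fun z hz => ?_
    -- Since `m * α ≤ 17`, this reduces to `1/16 + 17/512 ≤ 1/8`.
    have habs : α * n / 16 + m * (α ^ 2 * n / 512) ≤ α * n / 8 := by
      have h1 : (m : ℝ) * α ≤ 17 := by rwa [le_div_iff₀ hα] at hmle
      have h2 : (m : ℝ) * (α ^ 2 * n / 512) = m * α * (α * n / 512) := by ring
      rw [h2]
      have h3 : 0 ≤ α * n / 512 := by positivity
      nlinarith
    obtain ⟨l, hl⟩ := exists_norm_sub_le_of_cover (fun i => hw0 (z i)) (fun i => hw1 (z i))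
      (TopologicalSpace.denseRange_denseSeq _) (by positivity : 0 < 2 * σ)
      (by positivity : 0 < κ * α) hz.1 hz.2 (hJ z) habs
    refine ⟨l, hl.trans ?_⟩
    have h1 : 2 * (2 * σ) / (κ * α) = 4 / κ * (σ / α) := by
      field_simp
      norm_num
    rw [h1]
    gcongr
  have hfinal : (Measure.pi fun _ : Fin n => E).real ((fun z l => q (J z l)) ⁻¹'
      {l : Fin m → EuclideanSpace ℝ (Fin d) | ∃ i, ‖l i - β‖ ≤ C * (σ / α)})ᶜ ≤ τ :=
    ENNReal.toReal_le_of_le_ofReal hτ.le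
      ((measure_mono hsub).trans (hfail.trans (ENNReal.ofReal_le_ofReal hτle)))
  linarith

/-! ### Assembling the two bounds -/

lemma one_half_le_sqrt_log_one_div {α : ℝ} (hα : 0 < α) (hα2 : α < 1 / 2) :
    1 / 2 ≤ Real.sqrt (Real.log (1 / α)) := by
  refine Real.le_sqrt_of_sq_le ?_
  have h1 : Real.log 2 ≤ Real.log (1 / α) :=
    Real.log_le_log two_pos (by rw [le_div_iff₀ hα]; linarith)
  linarith [Real.log_two_gt_d9]

theorem theorem1p4 :
    -- upper bound
    (∃ C : ℝ, 0 < C ∧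
      ∀ (d : ℕ) (α σ τ : ℝ), 0 < d → 0 < α → α < 1 / 2 → 0 < σ → 0 < τ → τ < 1 →
        ∃ (n m : ℕ) (A : ListDecoder d n m),
          (n : ℝ) ≤ C * ((d : ℝ) + Real.log (1 / τ)) / α ^ 3 ∧
          (m : ℝ) ≤ C / α ∧
          ∀ (β : EuclideanSpace ℝ (Fin d)) (N : Measure (LabeledExample d)),
            IsProbabilityMeasure N →
            1 - τ ≤ A.prob (corrupted α (gaussianLinearRegression σ β) N)
              {l | ∃ i, ‖l i - β‖ ≤ C * ((σ / α) * Real.sqrt (Real.log (1 / α)))}) ∧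
    -- lower bound
    (∃ C : ℝ, 0 < C ∧
      ∀ K τ : ℝ, 0 < K → 0 < τ → τ < 1 →
        ∃ c : ℝ, 0 < c ∧
          ∀ (d : ℕ) (α σ k : ℝ), 0 < α → α < 1 / 2 → 0 < σ → 1 ≤ k →
            (k * Real.log (1 / α)) ^ C < (d : ℝ) →
            ∀ (n m : ℕ) (A : ListDecoder d n m), (m : ℝ) ≤ K * (1 / α) ^ k →
              ∃ (β : EuclideanSpace ℝ (Fin d)) (N : Measure (LabeledExample d)),
                IsProbabilityMeasure N ∧
                1 - τ ≤ A.prob (corrupted α (gaussianLinearRegression σ β) N)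
                  {l | ∀ i, c * (σ / (α * Real.sqrt (k * Real.log (1 / α)))) ≤ ‖l i - β‖}) := by
  constructor
  · obtain ⟨C, hC, h⟩ := listDecoder_upper_bound
    -- Doubling `C` compensates for the factor `√(log (1/α)) ≥ 1 / 2`.
    refine ⟨2 * C, by positivity, fun d α σ τ hd hα hα2 hσ hτ hτ1 => ?_⟩
    obtain ⟨n, m, A, hn, hm, hA⟩ := h d α σ τ hd hα hα2 hσ hτ hτ1
    have hlogτ : 0 < Real.log (1 / τ) := Real.log_pos ((one_lt_div hτ).2 hτ1)
    refine ⟨n, m, A, hn.trans ?_, hm.trans ?_, fun β N hN => (hA β N hN).trans ?_⟩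
    · gcongr
      linarith
    · gcongr
      linarith
    · have hE := isProbabilityMeasure_corrupted hα.le (by linarith)
        (gaussianLinearRegression σ β) N
      have := A.isMarkov
      refine measureReal_mono fun l ⟨i, hi⟩ => ⟨i, hi.trans ?_⟩
      have h1 := one_half_le_sqrt_log_one_div hα hα2
      have h2 : 0 < C * (σ / α) := by positivity
      nlinarith
  -- Exponent 1 suffices: linear growth of the dimension in `k log(1/α)` is all the packing needs.
  · refine ⟨1, one_pos, fun K τ hK hτ _ => ?_⟩
    simp only [Real.rpow_one]
    exact listDecoder_lower_bound hK hτ
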